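/- A path in a digraph $G=(V,E)$ is a nonempty sequence of vertices in which consecutive vertices are joined by edges (vertices may repeat); its hop $|p|$ is its number of edges, and its weight is the sum of the weights of its edges. A path from $u$ to $v$ is $h$-hop shortest if it has hop at most $h$ and its weight is minimum among all paths from $u$ to $v$ with hop at most $h$. A path $p$ is strongly-hop-dominant if it is $4|p|$-hop shortest. There is a deterministic algorithm (one fixed program for a random access machine with integer words and real numbers, the reals being only copied, added and compared) with the following property. Let $G$ be a digraph with $n$ vertices, $m$ edges and nonnegative real edge weights, such that for every $h$ and every pair of vertices $u,v$ there is at most one $h$-hop shortest path from $u$ to $v$. Given $G$ as a list of its $m$ weighted edges in any order, a vertex $s$ and a hop limit $H\in\mathbb{N}$, the algorithm computes, in $\tilde O(n+m)$ time and space, a set of paths in $G$ starting at $s$ that contains every strongly-hop-dominant path starting at $s$ with hop at most $H$. The paths are output as nodes of rooted trees: each node stores the last vertex of its path, its hop, its weight, and a pointer to the path without its last vertex. Here $\tilde O(f)$ means $O(f\cdot\operatorname{polylog} f)$ with absolute constants, and words have $O(\log(n+m+H+2))$ bits. -/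

import Mathlib

namespace HopPaths

/-! Paths in a weighted digraph. A path is its nonempty list of vertices; vertices may repeat. -/

section Paths

variable {V : Type*}

/-- `p` is a path from `u` to `v` in `G`. -/
def IsPath (G : Digraph V) (u v : V) (p : List V) : Prop :=
  p.IsChain G.Adj ∧ p.head? = some u ∧ p.getLast? = some v

/-- The hop of a path: its number of edges. -/
def hop (p : List V) : ℕ := p.length - 1

/-- The weight (length) of a path: the sum of the weights of its edges. -/
noncomputable def weight (w : V → V → ℝ) (p : List V) : ℝ :=
  (List.zipWith w p p.tail).sum

/-- `p` is an `h`-hop shortest `u`-`v` path: it has at most `h` edges, and its weight is minimum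
among all `u`-`v` paths with at most `h` edges. -/
def IsHopShortest (G : Digraph V) (w : V → V → ℝ) (h : ℕ) (u v : V) (p : List V) : Prop :=
  IsPath G u v p ∧ hop p ≤ h ∧
    ∀ q : List V, IsPath G u v q → hop q ≤ h → weight w p ≤ weight w q

/-- `p` is a strongly-hop-dominant `u`-`v` path: it is `4|p|`-hop shortest. -/
def IsStronglyHopDominant (G : Digraph V) (w : V → V → ℝ) (u v : V) (p : List V) : Prop :=
  IsHopShortest G w (4 * hop p) u v p

/-- For every `h`, the `h`-hop shortest paths between a pair of vertices are unique. -/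
def UniqueHopShortest (G : Digraph V) (w : V → V → ℝ) : Prop :=
  ∀ (h : ℕ) (u v : V) (p q : List V),
    IsHopShortest G w h u v p → IsHopShortest G w h u v q → p = q

end Paths

/-! The machine: a random access machine with integer words and real numbers. Control flow may
depend on comparisons; real numbers can only be copied, added and compared. A program is a fixed
finite piece of syntax, so it uses a fixed number of registers and of arrays. -/

/-- A configuration: integer registers, real registers, integer arrays and real arrays
(`nmem a i` is cell `i` of integer array number `a`). -/
structure State where
  nreg : ℕ → ℕ
  rreg : ℕ → ℝ
  nmem : ℕ → ℕ → ℕ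
  rmem : ℕ → ℕ → ℝ

/-- Elementary instructions. The arguments are register numbers, except that `k` is an integer
constant and `a` is an array number. -/
inductive Instr where
  /-- integer `x := k` -/
  | const (x k : ℕ)
  /-- integer `x := y` -/
  | copy (x y : ℕ)
  /-- integer `x := y + z` -/
  | add (x y z : ℕ)
  /-- integer `x := max (y - z) 0` -/
  | sub (x y z : ℕ)
  /-- integer `x := ⌊y / 2⌋` -/
  | half (x y : ℕ)
  /-- integer `x := a[y]` -/
  | load (x a y : ℕ)
  /-- integer `a[y] := x` -/
  | store (a y x : ℕ)
  /-- real `x := 0` -/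
  | rzero (x : ℕ)
  /-- real `x := y` -/
  | rcopy (x y : ℕ)
  /-- real `x := y + z` -/
  | radd (x y z : ℕ)
  /-- real `x := a[y]`, where `y` is an integer register -/
  | rload (x a y : ℕ)
  /-- real `a[y] := x`, where `y` is an integer register -/
  | rstore (a y x : ℕ)

/-- Write an integer register; this fails if the value is not a word, that is, not below `W`. -/
def State.setN (W : ℕ) (σ : State) (x k : ℕ) : Option State :=
  if k < W then some { σ with nreg := Function.update σ.nreg x k } else none

/-- Write a real register. -/
def State.setR (σ : State) (x : ℕ) (r : ℝ) : State :=
  { σ with rreg := Function.update σ.rreg x r }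

/-- Effect of an instruction on a machine whose arrays have `M` cells each and whose words are
the integers below `W`; `none` means that the instruction leaves these bounds. -/
noncomputable def Instr.exec (M W : ℕ) (σ : State) : Instr → Option State
  | .const x k => σ.setN W x k
  | .copy x y => σ.setN W x (σ.nreg y)
  | .add x y z => σ.setN W x (σ.nreg y + σ.nreg z)
  | .sub x y z => σ.setN W x (σ.nreg y - σ.nreg z)
  | .half x y => σ.setN W x (σ.nreg y / 2)
  | .load x a y => if σ.nreg y < M then σ.setN W x (σ.nmem a (σ.nreg y)) else none
  | .store a y x =>
      if σ.nreg y < M then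
        some { σ with
          nmem := Function.update σ.nmem a
            (Function.update (σ.nmem a) (σ.nreg y) (σ.nreg x)) }
      else none
  | .rzero x => some (σ.setR x 0)
  | .rcopy x y => some (σ.setR x (σ.rreg y))
  | .radd x y z => some (σ.setR x (σ.rreg y + σ.rreg z))
  | .rload x a y => if σ.nreg y < M then some (σ.setR x (σ.rmem a (σ.nreg y))) else none
  | .rstore a y x =>
      if σ.nreg y < M then
        some { σ with
          rmem := Function.update σ.rmem a
            (Function.update (σ.rmem a) (σ.nreg y) (σ.rreg x)) }
      else none

/-- Tests: comparison of two integer registers, or of two real registers. -/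
inductive Test where
  | lt (x y : ℕ)
  | eq (x y : ℕ)
  | rlt (x y : ℕ)

/-- Truth of a test in a configuration. -/
def Test.Holds (σ : State) : Test → Prop
  | .lt x y => σ.nreg x < σ.nreg y
  | .eq x y => σ.nreg x = σ.nreg y
  | .rlt x y => σ.rreg x < σ.rreg y

/-- Programs. -/
inductive Prog where
  | skip
  | instr (i : Instr)
  | seq (p q : Prog)
  | ite (b : Test) (p q : Prog)
  | loop (b : Test) (p : Prog)

/-- `Exec M W p σ t σ'`: started in `σ` on a machine whose arrays have `M` cells each and whose
words are the integers below `W`, the program `p` halts in `σ'` after exactly `t` steps, without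
leaving these bounds. Each instruction and each evaluation of a test is one step. -/
inductive Exec (M W : ℕ) : Prog → State → ℕ → State → Prop where
  | skip (σ : State) : Exec M W .skip σ 0 σ
  | instr {i : Instr} {σ σ' : State} (h : i.exec M W σ = some σ') :
      Exec M W (.instr i) σ 1 σ'
  | seq {p q : Prog} {σ σ' σ'' : State} {t t' : ℕ}
      (hp : Exec M W p σ t σ') (hq : Exec M W q σ' t' σ'') :
      Exec M W (.seq p q) σ (t + t') σ''
  | ite_true {b : Test} {p q : Prog} {σ σ' : State} {t : ℕ}
      (hb : b.Holds σ) (hp : Exec M W p σ t σ') :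
      Exec M W (.ite b p q) σ (t + 1) σ'
  | ite_false {b : Test} {p q : Prog} {σ σ' : State} {t : ℕ}
      (hb : ¬ b.Holds σ) (hq : Exec M W q σ t σ') :
      Exec M W (.ite b p q) σ (t + 1) σ'
  | loop_true {b : Test} {p : Prog} {σ σ' σ'' : State} {t t' : ℕ}
      (hb : b.Holds σ) (hp : Exec M W p σ t σ') (hl : Exec M W (.loop b p) σ' t' σ'') :
      Exec M W (.loop b p) σ (t + 1 + t') σ''
  | loop_false {b : Test} {p : Prog} {σ : State} (hb : ¬ b.Holds σ) :
      Exec M W (.loop b p) σ 1 σ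

/-! Input and output conventions. -/

/-- The input: registers `0, 1, 2, 3` hold `n, m, s, H`; the edges are listed in the order `e`,
with the tail and the head of edge `i` in cell `i` of integer arrays `0` and `1` and its weight in
cell `i` of real array `0`. Everything else is zero. -/
noncomputable def inputState {n m : ℕ} (e : Fin m → Fin n × Fin n) (w : Fin n → Fin n → ℝ)
    (s : Fin n) (H : ℕ) : State where
  nreg x := if x = 0 then n else if x = 1 then m else if x = 2 then s else if x = 3 then H else 0
  rreg _ := 0
  nmem a i :=
    if h : i < m then
      if a = 0 then (e ⟨i, h⟩).1 else if a = 1 then (e ⟨i, h⟩).2 else 0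
    else 0
  rmem a i := if h : i < m then if a = 0 then w (e ⟨i, h⟩).1 (e ⟨i, h⟩).2 else 0 else 0

/-- The vertex list obtained from record `i` by following `k` parent pointers. -/
def followParents (vertex parent : ℕ → ℕ) : ℕ → ℕ → List ℕ
  | 0, i => [vertex i]
  | k + 1, i => followParents vertex parent k (parent i) ++ [vertex i]

/-- The output is a family of records, their number being in register `0`. Record `i` stands for a
path: its last vertex, the record of the path without the last vertex, its hop, and its weight are
in cell `i` of integer arrays `2`, `3`, `4` and of real array `1`. -/
def storedPath (σ : State) (i : ℕ) : List ℕ :=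
  followParents (σ.nmem 2) (σ.nmem 3) (σ.nmem 4 i) i

/-- The set of paths that the output represents. -/
def outputPaths {n : ℕ} (σ : State) : Set (List (Fin n)) :=
  {p | ∃ i < σ.nreg 0, p.map Fin.val = storedPath σ i}

/-- The output is a correct representation of a set of paths from `s` in `G`, in `M` cells: every
record stands for a path from `s` and carries its weight (and its hop), and parent pointers point
to records. -/
def IsPathOutput {n : ℕ} (G : Digraph (Fin n)) (w : Fin n → Fin n → ℝ) (s : Fin n) (M : ℕ)
    (σ : State) : Prop :=
  σ.nreg 0 ≤ M ∧
  (∀ i < σ.nreg 0, 0 < σ.nmem 4 i →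
    σ.nmem 3 i < σ.nreg 0 ∧ σ.nmem 4 (σ.nmem 3 i) + 1 = σ.nmem 4 i) ∧
  ∀ i < σ.nreg 0, ∃ (v : Fin n) (p : List (Fin n)), IsPath G s v p ∧
    p.map Fin.val = storedPath σ i ∧ hop p = σ.nmem 4 i ∧ weight w p = σ.rmem 1 i

end HopPaths

set_option linter.unusedSimpArgs false

namespace HopPaths

/-! ### Hop-shortest paths: prefixes, uniqueness, simplicity -/

section PathLemmas

variable {V : Type*} {G : Digraph V} {w : V → V → ℝ}

/-! The algorithm runs a hop-limited variant of Dijkstra's algorithm for each limit `h = 1, 2, 4, …`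
below `2 * n`. In one run every vertex accepts at most one path, the lightest pending one, and an
accepted path is extended along edges only if its hop is below `h`. Such a run need not find `h`-hop
shortest paths, since a light path with many edges may displace a heavier one with few.

It does find every path `p` from `s` with hop at most `h` that is `(h + |p|)`-hop shortest
(`Scale.finish`). By induction on `p`, the path `p'` without the last edge is `(h + |p'|)`-hop
shortest, hence is the accepted path of its end. Its hop is below `h`, so its last edge was relaxed,
and the path accepted at the end of `p` is no heavier than `p`. That path has hop at most `h`,
within the budget `h + |p|`, so uniqueness makes it equal to `p`.

If `p` is strongly-hop-dominant with at least one edge, take the power of two `h` with `|p| < h ≤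
2|p|`; then `h + |p| ≤ 4|p|`. Moreover `p` is simple (`IsHopShortest.nodup`), so `h < 2 * n`, and
logarithmically many runs suffice for every hop limit.

A run relaxes each edge at most once, so it creates at most `m` records; a tournament tree over the
vertices serves as priority queue, at logarithmic cost per step. The rest of the proof carries these
invariants through the machine program. -/

theorem IsPath.ne_nil {u v : V} {p : List V} (h : IsPath G u v p) : p ≠ [] := by
  rintro rfl
  simp [IsPath] at h

theorem isPath_singleton (s : V) : IsPath G s s [s] := by
  simp [IsPath]

theorem weight_singleton (s : V) : weight w [s] = 0 := by
  simp [weight]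

theorem hop_append_singleton {p : List V} (hp : p ≠ []) (v : V) :
    hop (p ++ [v]) = hop p + 1 := by
  have := List.length_pos_iff.2 hp
  simp only [hop, List.length_append, List.length_singleton]
  omega

theorem weight_append_singleton {p : List V} {u : V} (h : p.getLast? = some u) (v : V) :
    weight w (p ++ [v]) = weight w p + w u v := by
  induction p with
  | nil => simp at h
  | cons a t ih =>
    cases t with
    | nil =>
      simp at h
      simp [weight, h]
    | cons b t =>
      have h' : (b :: t).getLast? = some u := by simpa using h
      have := ih h'
      simp only [weight, List.cons_append, List.tail_cons, List.zipWith_cons_cons,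
        List.sum_cons] at this ⊢
      rw [this]
      ring

theorem isPath_append_singleton {s v x : V} {p : List V} (hp : p ≠ []) :
    IsPath G s v (p ++ [x]) ↔ x = v ∧ ∃ u, IsPath G s u p ∧ G.Adj u x := by
  obtain ⟨q, y, rfl⟩ : ∃ q y, p = q ++ [y] := ⟨_, _, (List.dropLast_concat_getLast hp).symm⟩
  simp only [IsPath, List.isChain_append, List.head?_append]
  constructor
  · rintro ⟨⟨h1, -, h2⟩, h3, h4⟩
    refine ⟨by simpa using h4, y, ⟨h1, ?_, by simp⟩, h2 y (by simp) x (by simp)⟩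
    cases q <;> simpa using h3
  · rintro ⟨rfl, u, ⟨h1, h2, h3⟩, h4⟩
    have : y = u := by simpa using h3
    subst this
    refine ⟨⟨h1, by simp, ?_⟩, ?_, by simp⟩
    · intro a ha b hb
      simp at ha hb
      rwa [← ha, ← hb]
    · cases q <;> simpa using h2

theorem IsPath.prefix {s v : V} {a : List V} (hw : ∀ u v, G.Adj u v → 0 ≤ w u v) (ha : a ≠ [])
    (b : List V) (h : IsPath G s v (a ++ b)) :
    ∃ u, IsPath G s u a ∧ weight w a ≤ weight w (a ++ b) := by
  induction b using List.reverseRecOn generalizing v with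
  | nil => exact ⟨v, by simpa using h, by simp⟩
  | append_singleton b x ih =>
    rw [← List.append_assoc] at h ⊢
    obtain ⟨rfl, y, hy, hyx⟩ := (isPath_append_singleton (by simp [ha])).1 h
    obtain ⟨u, hu, hle⟩ := ih hy
    refine ⟨u, hu, ?_⟩
    rw [weight_append_singleton hy.2.2]
    linarith [hw _ _ hyx]

/-- A lighter competitor of the prefix, extended by the last edge, would be a lighter competitor of
the whole path. -/
theorem IsHopShortest.init {K : ℕ} {s u v : V} {p : List V}
    (h : IsHopShortest G w (K + 1) s v (p ++ [v])) (hp : IsPath G s u p) (huv : G.Adj u v) :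
    IsHopShortest G w K s u p := by
  obtain ⟨-, h2, h3⟩ := h
  rw [hop_append_singleton hp.ne_nil] at h2
  refine ⟨hp, by omega, fun q hq hqK => ?_⟩
  have := h3 (q ++ [v]) ((isPath_append_singleton hq.ne_nil).2 ⟨rfl, u, hq, huv⟩)
    (by rw [hop_append_singleton hq.ne_nil]; omega)
  rw [weight_append_singleton hp.2.2, weight_append_singleton hq.2.2] at this
  linarith

theorem IsHopShortest.mono {K K' : ℕ} {s v : V} {p : List V} (h : IsHopShortest G w K s v p)
    (hp : hop p ≤ K') (hK : K' ≤ K) : IsHopShortest G w K' s v p :=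
  ⟨h.1, hp, fun q hq hqK => h.2.2 q hq (hqK.trans hK)⟩

/-- The form in which uniqueness is used: a path within the hop budget that is no heavier than a
shortest one is itself shortest. -/
theorem IsHopShortest.eq_of_le (hu : UniqueHopShortest G w) {K : ℕ} {s v : V} {p q : List V}
    (h : IsHopShortest G w K s v p) (hq : IsPath G s v q) (hqK : hop q ≤ K)
    (hle : weight w q ≤ weight w p) : q = p :=
  hu K s v q p ⟨hq, hqK, fun r hr hrK => hle.trans (h.2.2 r hr hrK)⟩ h

/-- If the last vertex occurred earlier, the prefix ending there would have the same ends, fewer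
edges and, as weights are nonnegative, no larger weight, against uniqueness. -/
theorem IsHopShortest.nodup (hw : ∀ u v, G.Adj u v → 0 ≤ w u v) (hu : UniqueHopShortest G w)
    {K : ℕ} {s v : V} {p : List V} (h : IsHopShortest G w K s v p) : p.Nodup := by
  induction p using List.reverseRecOn generalizing K v with
  | nil => simp
  | append_singleton p x ih =>
    rcases eq_or_ne p [] with rfl | hp
    · simp
    obtain ⟨rfl, u, hpu, hux⟩ := (isPath_append_singleton hp).1 h.1
    obtain ⟨K, rfl⟩ : ∃ K', K = K' + 1 := by
      have := h.2.1
      rw [hop_append_singleton hp] at this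
      exact ⟨K - 1, by omega⟩
    have hnd := ih (h.init hpu hux)
    have hx : x ∉ p := by
      intro hx
      obtain ⟨a, b, rfl⟩ := List.append_of_mem hx
      have e : a ++ x :: b ++ [x] = (a ++ [x]) ++ (b ++ [x]) := by simp
      obtain ⟨y, hy, hle⟩ := IsPath.prefix hw (by simp) (b ++ [x]) (e ▸ h.1)
      obtain rfl : y = x := by simpa using hy.2.2.symm
      have := h.eq_of_le hu hy ?_ (by rw [e]; exact hle)
      · simpa using congrArg List.length this
      · refine le_trans ?_ h.2.1
        simp only [hop, List.length_append, List.length_cons, List.length_nil]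
        omega
    simp [List.nodup_append, hnd]
    rintro a ha rfl
    exact hx ha

end PathLemmas

/-! ### Paths stored as records with parent pointers -/

section Records

variable {n : ℕ}

/-- Records `0, …, q - 1` represent paths from `s`, record `r` the path `P r`; record `0` is the
path without edges. -/
structure Records (G : Digraph (Fin n)) (w : Fin n → Fin n → ℝ) (s : Fin n) (q : ℕ)
    (vert par hp : ℕ → ℕ) (wt : ℕ → ℝ) (P : ℕ → List (Fin n)) : Prop where
  pos : 0 < q
  vert_zero : vert 0 = s
  hp_zero : hp 0 = 0
  wt_zero : wt 0 = 0
  path_zero : P 0 = [s]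
  step : ∀ r, 0 < r → r < q → par r < r ∧ hp r = hp (par r) + 1 ∧
    ∃ u v : Fin n, G.Adj u v ∧ vert (par r) = u ∧ vert r = v ∧
      wt r = wt (par r) + w u v ∧ P r = P (par r) ++ [v]

variable {G : Digraph (Fin n)} {w : Fin n → Fin n → ℝ} {s : Fin n} {q : ℕ}
  {vert par hp : ℕ → ℕ} {wt : ℕ → ℝ} {P : ℕ → List (Fin n)}

/-- Strong induction on the record number, as parents have smaller numbers. The function `P` exists
only in the proof; the machine stores the other four. -/
theorem Records.spec (h : Records G w s q vert par hp wt P) (r : ℕ) (hr : r < q) :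
    ∃ v : Fin n, vert r = v ∧ IsPath G s v (P r) ∧ hop (P r) = hp r ∧ weight w (P r) = wt r ∧
      (P r).map Fin.val = followParents vert par (hp r) r := by
  induction r using Nat.strong_induction_on with
  | _ r ih =>
    rcases Nat.eq_zero_or_pos r with rfl | h0
    · refine ⟨s, h.vert_zero, ?_⟩
      rw [h.path_zero, h.hp_zero, h.wt_zero]
      exact ⟨isPath_singleton s, rfl, weight_singleton s, by simp [followParents, h.vert_zero]⟩
    · obtain ⟨hlt, hhp, u, v, huv, hu, hv, hwt, hP⟩ := h.step r h0 hr
      obtain ⟨u', hu', hpath, hhop, hweight, hmap⟩ := ih _ hlt (hlt.trans hr)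
      obtain rfl : u' = u := Fin.ext (by rw [← hu', hu])
      refine ⟨v, hv, ?_⟩
      rw [hP, hhp, hwt]
      refine ⟨(isPath_append_singleton hpath.ne_nil).2 ⟨rfl, u', hpath, huv⟩, ?_, ?_, ?_⟩
      · rw [hop_append_singleton hpath.ne_nil, hhop]
      · rw [weight_append_singleton hpath.2.2, hweight]
      · simp [followParents, hmap, hv]

theorem Records.push (h : Records G w s q vert par hp wt P) {R : ℕ} (hR : R < q) {u v : Fin n}
    (hu : vert R = u) (huv : G.Adj u v) :
    Records G w s (q + 1) (Function.update vert q v) (Function.update par q R)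
      (Function.update hp q (hp R + 1)) (Function.update wt q (wt R + w u v))
      (Function.update P q (P R ++ [v])) := by
  have h0 : 0 ≠ q := h.pos.ne
  refine ⟨by omega, ?_, ?_, ?_, ?_, ?_⟩
  · rw [Function.update_of_ne h0, h.vert_zero]
  · rw [Function.update_of_ne h0, h.hp_zero]
  · rw [Function.update_of_ne h0, h.wt_zero]
  · rw [Function.update_of_ne h0, h.path_zero]
  · intro r hr hrq
    rcases eq_or_ne r q with rfl | hne
    · simp only [Function.update_self, Function.update_of_ne hR.ne]
      exact ⟨hR, trivial, u, v, huv, hu, rfl, rfl, rfl⟩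
    · obtain ⟨hlt, hrest⟩ := h.step r hr (by omega)
      simp only [Function.update_of_ne hne, Function.update_of_ne (show par r ≠ q by omega)]
      exact ⟨hlt, hrest⟩

end Records

/-! ### One run with a fixed hop limit -/

section Scale

variable {n m : ℕ}

/-- The invariant of one run with hop limit `h`. The current vertex is `u`, whose edges with
numbers at least `cur` have been relaxed; `ℓ v` is the pending record of `v` (`0` if there is
none), and `A v` is the accepted record of `v` if `done v = h`. -/
structure Scale (w : Fin n → Fin n → ℝ) (src dst : Fin m → Fin n) (s : Fin n) (h q cur : ℕ)
    (vert hp done : ℕ → ℕ) (wt : ℕ → ℝ) (u : Fin n) (ℓ A : Fin n → ℕ) : Prop where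
  pending : ∀ v, ℓ v ≠ 0 → ℓ v < q ∧ vert (ℓ v) = v ∧ hp (ℓ v) ≤ h ∧ done v ≠ h
  accepted : ∀ v : Fin n, done v = h → A v < q ∧ vert (A v) = v ∧ hp (A v) ≤ h
  source : done s = h ∧ A s = 0
  current : done u = h
  cur_le : cur ≤ m
  cur_src : ∀ i : Fin m, cur = i + 1 → src i = u
  accepted_le : ∀ v : Fin n, done v = h → wt (A v) ≤ wt (A u)
  le_pending : ∀ v, ℓ v ≠ 0 → wt (A u) ≤ wt (ℓ v)
  relaxed : ∀ i : Fin m, done (src i) = h → (src i = u → cur ≤ i) → hp (A (src i)) < h →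
    (done (dst i) = h ∧ wt (A (dst i)) ≤ wt (A (src i)) + w (src i) (dst i)) ∨
    (ℓ (dst i) ≠ 0 ∧ wt (ℓ (dst i)) ≤ wt (A (src i)) + w (src i) (dst i))

/-- Adjacency lists: `head v` and `next i` are `0` or one more than the number of an edge. -/
structure Adjacency (src : Fin m → Fin n) (head next : ℕ → ℕ) : Prop where
  head_le : ∀ v : Fin n, head v ≤ m
  head_src : ∀ (v : Fin n) (i : Fin m), head v = i + 1 → src i = v
  lt_head : ∀ i : Fin m, (i : ℕ) < head (src i)
  next_le : ∀ i : Fin m, next i ≤ i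
  next_src : ∀ i j : Fin m, next i = j + 1 → src j = src i
  lt_next : ∀ i j : Fin m, j < i → src j = src i → (j : ℕ) < next i

/-- The better one of two records, where `0` stands for no record. -/
noncomputable def better (wt : ℕ → ℝ) (a b : ℕ) : ℕ :=
  if a = 0 then b else if b = 0 then a else if wt b < wt a then b else a

/-- The edges that are not yet relaxed. -/
def unrelaxed (src : Fin m → Fin n) (h cur : ℕ) (done : ℕ → ℕ) (u : Fin n) : Finset (Fin m) :=
  {i | done (src i) ≠ h ∨ (src i = u ∧ (i : ℕ) < cur)}

/-- The vertices without accepted record. -/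
def undone (n h : ℕ) (done : ℕ → ℕ) : Finset (Fin n) :=
  {v | done v ≠ h}

variable {w : Fin n → Fin n → ℝ} {src dst : Fin m → Fin n} {s : Fin n} {h q cur : ℕ}
  {vert hp done head next : ℕ → ℕ} {wt : ℕ → ℝ} {u : Fin n} {ℓ A : Fin n → ℕ}

/-- `done v` keeps the last hop limit under which `v` was accepted. Earlier limits are smaller than
`h`, so nothing counts as accepted at the start of a run and the array needs no clearing. -/
theorem Scale.init (hadj : Adjacency src head next) (hq : 0 < q) (hdone : ∀ v : Fin n, done v < h)
    (hvert : vert 0 = s) (hhp : hp 0 = 0) :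
    Scale w src dst s h q (head s) vert hp (Function.update done s h) wt s
      (fun _ => 0) (fun _ => 0) := by
  have key : ∀ v : Fin n, Function.update done s h v = h → v = s := by
    intro v hv
    by_contra hne
    rw [Function.update_of_ne (by simpa [Fin.ext_iff] using hne)] at hv
    exact (hdone v).ne hv
  refine ⟨by simp, ?_, by simp, by simp, hadj.head_le s, hadj.head_src s, by simp, by simp, ?_⟩
  · intro v hv
    obtain rfl := key v hv
    exact ⟨hq, hvert, by simp [hhp]⟩
  · intro i hi hcur
    have := key _ hi
    have h1 := hcur this
    have h2 := hadj.lt_head i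
    rw [this] at h2
    omega

/-- Minimality of the chosen record keeps the accepted weights below the pending ones. Since `cur =
0`, all edges of the old current vertex are relaxed; those of `v` all have numbers below `head v`
and are still to come. -/
theorem Scale.pop (H : Scale w src dst s h q 0 vert hp done wt u ℓ A)
    (hadj : Adjacency src head next) {v : Fin n} (hv : ℓ v ≠ 0)
    (hmin : ∀ x, ℓ x ≠ 0 → wt (ℓ v) ≤ wt (ℓ x)) :
    Scale w src dst s h q (head v) vert hp (Function.update done v h) wt v
      (Function.update ℓ v 0) (Function.update A v (ℓ v)) := by
  obtain ⟨hlt, hvv, hhop, hnd⟩ := H.pending v hv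
  have hd : ∀ x : Fin n, x ≠ v → Function.update done v h x = done x := by
    intro x hx
    rw [Function.update_of_ne (by simpa [Fin.ext_iff] using hx)]
  have hold : ∀ x : Fin n, done x = h → x ≠ v := by rintro x hx rfl; exact hnd hx
  have hs := hold s H.source.1
  refine ⟨?_, ?_, ?_, by simp, hadj.head_le v, hadj.head_src v, ?_, ?_, ?_⟩
  · intro x hx
    rcases eq_or_ne x v with rfl | hne
    · simp at hx
    · rw [Function.update_of_ne hne] at hx ⊢
      rw [hd x hne]
      exact H.pending x hx
  · intro x hx
    rcases eq_or_ne x v with rfl | hne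
    · simpa using ⟨hlt, hvv, hhop⟩
    · rw [hd x hne] at hx
      rw [Function.update_of_ne hne]
      exact H.accepted x hx
  · rw [hd s hs, Function.update_of_ne hs]
    exact H.source
  · intro x hx
    rw [Function.update_self]
    rcases eq_or_ne x v with rfl | hne
    · simp
    · rw [hd x hne] at hx
      rw [Function.update_of_ne hne]
      exact (H.accepted_le x hx).trans (H.le_pending v hv)
  · intro x hx
    rw [Function.update_self]
    rcases eq_or_ne x v with rfl | hne
    · simp at hx
    · rw [Function.update_of_ne hne] at hx ⊢
      exact hmin x hx
  · intro i hi hcur hhp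
    have hne : src i ≠ v := by
      intro he
      have h1 := hcur he
      have h2 := hadj.lt_head i
      rw [he] at h2
      omega
    rw [hd _ hne] at hi
    rw [Function.update_of_ne hne] at hhp ⊢
    rcases eq_or_ne (dst i) v with he | hne'
    · left
      refine ⟨by simp [he], ?_⟩
      rcases H.relaxed i hi (by simp) hhp with h1 | h1
      · exact absurd h1.1 (by rw [he]; exact hnd)
      · rw [he, Function.update_self]
        rw [he] at h1
        exact h1.2
    · rw [hd _ hne', Function.update_of_ne hne', Function.update_of_ne hne']
      exact H.relaxed i hi (by simp) hhp

/-- An edge may be dropped if the hop limit is reached or if its head is already accepted: accepted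
weights are at most that of `u`, and the edge weight is nonnegative. -/
theorem Scale.skip {i : Fin m} (hw : ∀ i, 0 ≤ w (src i) (dst i))
    (H : Scale w src dst s h q (i + 1) vert hp done wt u ℓ A) (hadj : Adjacency src head next)
    (hi : hp (A u) < h → done (dst i) = h) :
    Scale w src dst s h q (next i) vert hp done wt u ℓ A := by
  have hsrc : src i = u := H.cur_src i rfl
  refine ⟨H.pending, H.accepted, H.source, H.current, ?_, ?_, H.accepted_le, H.le_pending, ?_⟩
  · exact (hadj.next_le i).trans i.2.le
  · intro j hj
    rw [← hsrc]
    exact hadj.next_src i j hj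
  · intro j hj hcur hhp
    by_cases hju : src j = u
    -- Adjacency lists run through edge numbers downwards: edges below `i` remain to be relaxed, `i`
    -- is the new one, and those above were relaxed before.
    · rcases lt_trichotomy j i with hlt | rfl | hgt
      · have h1 := hadj.lt_next i j hlt (by rw [hju, hsrc])
        have h2 := hcur hju
        omega
      · left
        rw [hju] at hhp
        refine ⟨hi hhp, ?_⟩
        have := H.accepted_le _ (hi hhp)
        have := hw j
        rw [hju] at this ⊢
        linarith
      · exact H.relaxed j hj (fun _ => by simpa using hgt) hhp
    · exact H.relaxed j hj (fun h => absurd h hju) hhp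

theorem better_eq_or (wt : ℕ → ℝ) (a b : ℕ) : better wt a b = a ∨ better wt a b = b := by
  unfold better
  split_ifs <;> simp

theorem better_spec {a b : ℕ} (h : a ≠ 0 ∨ b ≠ 0) :
    better wt a b ≠ 0 ∧ (a ≠ 0 → wt (better wt a b) ≤ wt a) ∧
      (b ≠ 0 → wt (better wt a b) ≤ wt b) := by
  unfold better
  split_ifs with h1 h2 h3
  · exact ⟨by tauto, by tauto, by simp⟩
  · exact ⟨by tauto, by simp, by tauto⟩
  · exact ⟨by tauto, fun _ => h3.le, by simp⟩
  · exact ⟨by tauto, by simp, fun _ => not_lt.1 h3⟩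

theorem better_congr {wt' : ℕ → ℝ} {a b : ℕ} (ha : wt' a = wt a) (hb : wt' b = wt b) :
    better wt' a b = better wt a b := by
  simp only [better, ha, hb]

/-- The new path becomes record `q` even if it loses against the pending record of its end. Older
records are untouched, so only the comparison at `dst i` is new. -/
theorem Scale.relax {i : Fin m} (hw : ∀ i, 0 ≤ w (src i) (dst i)) (hq : 0 < q)
    (H : Scale w src dst s h q (i + 1) vert hp done wt u ℓ A) (hadj : Adjacency src head next)
    (hhp : hp (A u) < h) (hnd : done (dst i) ≠ h) {wt' : ℕ → ℝ}
    (hwt' : wt' = Function.update wt q (wt (A u) + w (src i) (dst i))) :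
    Scale w src dst s h (q + 1) (next i) (Function.update vert q (dst i))
      (Function.update hp q (hp (A u) + 1)) done wt' u
      (Function.update ℓ (dst i) (better wt' (ℓ (dst i)) q)) A := by
  have hsrc : src i = u := H.cur_src i rfl
  have hwq : wt' q = wt (A u) + w (src i) (dst i) := by simp [hwt']
  have hold : ∀ r, r < q → wt' r = wt r := fun r hr => by
    rw [hwt', Function.update_of_ne hr.ne]
  have hA : ∀ v : Fin n, done v = h → wt' (A v) = wt (A v) := fun v hv => hold _ (H.accepted v hv).1
  have hL : ∀ v : Fin n, ℓ v ≠ 0 → wt' (ℓ v) = wt (ℓ v) := fun v hv => hold _ (H.pending v hv).1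
  obtain ⟨hb0, hb1, hb2⟩ := better_spec (wt := wt') (a := ℓ (dst i)) (b := q) (Or.inr hq.ne')
  have hb := better_eq_or wt' (ℓ (dst i)) q
  have hu := hA u H.current
  refine ⟨?_, ?_, H.source, H.current, (hadj.next_le i).trans i.2.le, ?_, ?_, ?_, ?_⟩
  · intro v hv
    have aux : ∀ v, ℓ v ≠ 0 → ℓ v < q + 1 ∧ Function.update vert q (dst i) (ℓ v) = v ∧
        Function.update hp q (hp (A u) + 1) (ℓ v) ≤ h ∧ done v ≠ h := by
      intro v hv
      obtain ⟨h1, h2, h3, h4⟩ := H.pending v hv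
      rw [Function.update_of_ne h1.ne, Function.update_of_ne h1.ne]
      exact ⟨by omega, h2, h3, h4⟩
    rcases eq_or_ne v (dst i) with rfl | hne
    · rw [Function.update_self] at hv ⊢
      rcases hb with hb | hb
      · rw [hb] at hv ⊢
        exact aux _ hv
      · rw [hb]
        simp only [Function.update_self]
        exact ⟨by omega, trivial, hhp, hnd⟩
    · rw [Function.update_of_ne hne] at hv ⊢
      exact aux v hv
  · intro v hv
    obtain ⟨h1, h2, h3⟩ := H.accepted v hv
    rw [Function.update_of_ne h1.ne, Function.update_of_ne h1.ne]
    exact ⟨by omega, h2, h3⟩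
  · intro j hj
    rw [← hsrc]
    exact hadj.next_src i j hj
  · intro v hv
    rw [hA v hv, hu]
    exact H.accepted_le v hv
  · intro v hv
    rw [hu]
    rcases eq_or_ne v (dst i) with rfl | hne
    · rw [Function.update_self] at hv ⊢
      rcases hb with hb | hb
      · rw [hb] at hv ⊢
        rw [hL _ hv]
        exact H.le_pending _ hv
      · rw [hb, hwq]
        linarith [hw i]
    · rw [Function.update_of_ne hne] at hv ⊢
      rw [hL _ hv]
      exact H.le_pending _ hv
  · intro j hj hcur hhj
    have hjA := (H.accepted _ hj).1
    rw [Function.update_of_ne hjA.ne] at hhj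
    rw [hA _ hj]
    have aux : (src j = u → (i : ℕ) + 1 ≤ j) →
        (done (dst j) = h ∧ wt' (A (dst j)) ≤ wt (A (src j)) + w (src j) (dst j)) ∨
        (Function.update ℓ (dst i) (better wt' (ℓ (dst i)) q) (dst j) ≠ 0 ∧
          wt' (Function.update ℓ (dst i) (better wt' (ℓ (dst i)) q) (dst j)) ≤
            wt (A (src j)) + w (src j) (dst j)) := by
      intro hc
      rcases H.relaxed j hj hc hhj with ⟨h1, h2⟩ | ⟨h1, h2⟩
      · left
        rw [hA _ h1]
        exact ⟨h1, h2⟩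
      · right
        rcases eq_or_ne (dst j) (dst i) with he | hne
        · rw [he, Function.update_self]
          rw [he] at h1 h2
          refine ⟨hb0, (hb1 h1).trans ?_⟩
          rw [hL _ h1]
          exact h2
        · rw [Function.update_of_ne hne, hL _ h1]
          exact ⟨h1, h2⟩
    by_cases hju : src j = u
    · rcases lt_trichotomy j i with hlt | rfl | hgt
      · have h1 := hadj.lt_next i j hlt (by rw [hju, hsrc])
        have h2 := hcur hju
        omega
      · right
        rw [Function.update_self]
        refine ⟨hb0, (hb2 hq.ne').trans ?_⟩
        rw [hwq, hsrc]
      · exact aux fun _ => by simpa using hgt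
    · exact aux fun h => absurd h hju

/-- The central argument. With an empty queue, each edge leaving an accepted path of hop below `h`
bounds the weight accepted at its head. The budget `h + hop p` drops by one with each removed edge,
so the induction applies to prefixes. -/
theorem Scale.finish {G : Digraph (Fin n)} {par : ℕ → ℕ} {P : ℕ → List (Fin n)}
    (hu : UniqueHopShortest G w) (hE : ∀ x y, G.Adj x y → ∃ i, src i = x ∧ dst i = y)
    (H : Scale w src dst s h q 0 vert hp done wt u ℓ A) (hℓ : ∀ v, ℓ v = 0)
    (hrec : Records G w s q vert par hp wt P) {v : Fin n} {p : List (Fin n)}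
    (hps : IsHopShortest G w (h + hop p) s v p) (hph : hop p ≤ h) :
    done v = h ∧ P (A v) = p := by
  induction p using List.reverseRecOn generalizing v with
  | nil => exact absurd rfl hps.1.ne_nil
  | append_singleton p x ih =>
    rcases eq_or_ne p [] with rfl | hp0
    · obtain ⟨-, h1, h2⟩ := hps.1
      simp at h1 h2
      subst h1 h2
      rw [H.source.2, hrec.path_zero]
      exact ⟨H.source.1, rfl⟩
    · obtain ⟨rfl, y, hy, hyx⟩ := (isPath_append_singleton hp0).1 hps.1
      have hhop := hop_append_singleton hp0 x
      rw [hhop] at hph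
      have hps' := hps
      rw [hhop, ← add_assoc] at hps'
      obtain ⟨hd, hA⟩ := ih (hps'.init hy hyx) (by omega)
      obtain ⟨i, rfl, rfl⟩ := hE _ _ hyx
      obtain ⟨y', hy', hpath, hhop', hwt, -⟩ := hrec.spec _ (H.accepted _ hd).1
      rw [hA] at hhop' hwt
      rcases H.relaxed i hd (by simp) (by omega) with ⟨h1, h2⟩ | ⟨h1, -⟩
      · refine ⟨h1, ?_⟩
        obtain ⟨h3, h4, h5⟩ := H.accepted _ h1
        obtain ⟨z, hz, hzp, hzh, hzw, -⟩ := hrec.spec _ h3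
        obtain rfl : z = dst i := Fin.ext (by rw [← hz, h4])
        -- The accepted path may have more edges than `p`, but at most `h`, which is why the budget
        -- exceeds `hop p` by `h`.
        refine hps.eq_of_le hu hzp (by omega) ?_
        rw [hzw, weight_append_singleton hy.2.2, hwt]
        exact h2
      · exact absurd (hℓ _) h1

theorem unrelaxed_card_relax {i : Fin m} (hadj : Adjacency src head next) (hi : src i = u)
    (hd : done u = h) :
    (unrelaxed src h (next i) done u).card + 1 ≤ (unrelaxed src h (i + 1) done u).card := by
  refine Finset.card_lt_card (Finset.ssubset_iff_subset_ne.2 ⟨?_, ?_⟩)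
  · intro j hj
    have := hadj.next_le i
    simp only [unrelaxed, Finset.mem_filter, Finset.mem_univ, true_and] at hj ⊢
    exact hj.imp id fun h => ⟨h.1, by omega⟩
  · intro he
    have : i ∈ unrelaxed src h (i + 1) done u := by simp [unrelaxed, hi]
    rw [← he] at this
    have h2 := hadj.next_le i
    simp only [unrelaxed, Finset.mem_filter, Finset.mem_univ, true_and, hi, hd] at this
    rcases this with h | h
    · exact h rfl
    · omega

/-- The vertex `v` was not accepted before, so its edges already counted as unrelaxed. -/
theorem unrelaxed_card_pop {v : Fin n} (c : ℕ) (hd : done v ≠ h) :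
    (unrelaxed src h c (Function.update done v h) v).card ≤ (unrelaxed src h 0 done u).card := by
  refine Finset.card_le_card fun j hj => ?_
  simp only [unrelaxed, Finset.mem_filter, Finset.mem_univ, true_and] at hj ⊢
  left
  rcases eq_or_ne (src j) v with he | hne
  · rwa [he]
  · rcases hj with hj | hj
    · rwa [Function.update_of_ne (by simpa [Fin.ext_iff] using hne)] at hj
    · exact absurd hj.1 hne

theorem undone_card_pop {v : Fin n} (hd : done v ≠ h) :
    (undone n h (Function.update done v h)).card + 1 ≤ (undone n h done).card := by
  refine Finset.card_lt_card (Finset.ssubset_iff_subset_ne.2 ⟨?_, ?_⟩)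
  · intro x hx
    simp only [undone, Finset.mem_filter, Finset.mem_univ, true_and] at hx ⊢
    rcases eq_or_ne x v with rfl | hne
    · exact hd
    · rwa [Function.update_of_ne (by simpa [Fin.ext_iff] using hne)] at hx
  · intro he
    have : v ∈ undone n h done := by simpa [undone] using hd
    rw [← he] at this
    simp [undone] at this

end Scale

/-! ### The tournament tree as priority queue -/

section Tournament

variable {n : ℕ}

/-- The tree `T` with leaves `n, …, 2 * n - 1` and root `1` holds the records `ℓ v` at its leaves
and the better one of the records of the children at each inner node. -/
structure Tournament (T : ℕ → ℕ) (wt : ℕ → ℝ) (ℓ : Fin n → ℕ) : Prop where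
  leaf : ∀ v : Fin n, T (n + v) = ℓ v
  node : ∀ j, 1 ≤ j → j < n → T j = better wt (T (2 * j)) (T (2 * j + 1))

variable {T : ℕ → ℕ} {wt : ℕ → ℝ} {ℓ : Fin n → ℕ}

/-- Descend to the winning child. The number of leaves need not be a power of two: the children of
`j < n` are below `2 * n`. -/
theorem Tournament.eq_leaf (hT : Tournament T wt ℓ) (j : ℕ) (h1 : 1 ≤ j) (h2 : j < 2 * n) :
    ∃ v : Fin n, T j = ℓ v := by
  by_cases hj : n ≤ j
  · refine ⟨⟨j - n, by omega⟩, ?_⟩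
    rw [← hT.leaf]
    congr 1
    simp only
    omega
  · rw [hT.node j h1 (by omega)]
    rcases better_eq_or wt (T (2 * j)) (T (2 * j + 1)) with h | h <;> rw [h]
    · exact hT.eq_leaf (2 * j) (by omega) (by omega)
    · exact hT.eq_leaf (2 * j + 1) (by omega) (by omega)
termination_by 2 * n - j

/-- Climb from `j` to `j / 2`: a parent is at least as good as its nonempty child. -/
theorem Tournament.root_le (hT : Tournament T wt ℓ) (j : ℕ) (h1 : 1 ≤ j) (h2 : j < 2 * n)
    (h0 : T j ≠ 0) : T 1 ≠ 0 ∧ wt (T 1) ≤ wt (T j) := by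
  induction j using Nat.strong_induction_on with
  | _ j ih =>
    rcases eq_or_lt_of_le h1 with rfl | hlt
    · exact ⟨h0, le_rfl⟩
    · have hn := hT.node (j / 2) (by omega) (by omega)
      have key : T (j / 2) ≠ 0 ∧ wt (T (j / 2)) ≤ wt (T j) := by
        rcases Nat.mod_two_eq_zero_or_one j with hj | hj
        · have e : 2 * (j / 2) = j := by omega
          rw [e] at hn
          obtain ⟨k1, k2, -⟩ := better_spec (wt := wt) (b := T (j + 1)) (Or.inl h0)
          rw [hn]
          exact ⟨k1, k2 h0⟩
        · have e : 2 * (j / 2) + 1 = j := by omega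
          rw [e] at hn
          obtain ⟨k1, -, k2⟩ := better_spec (wt := wt) (a := T (2 * (j / 2))) (Or.inr h0)
          rw [hn]
          exact ⟨k1, k2 h0⟩
      obtain ⟨k1, k2⟩ := ih (j / 2) (by omega) (by omega) (by omega) key.1
      exact ⟨k1, k2.trans key.2⟩

/-- Needed because the weight of a new record is written before the record enters the tree. -/
theorem Tournament.congr_weight (hT : Tournament T wt ℓ) {wt' : ℕ → ℝ}
    (h : ∀ v, wt' (ℓ v) = wt (ℓ v)) : Tournament T wt' ℓ := by
  refine ⟨hT.leaf, fun j h1 h2 => ?_⟩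
  rw [hT.node j h1 h2]
  obtain ⟨a, ha⟩ := hT.eq_leaf (2 * j) (by omega) (by omega)
  obtain ⟨b, hb⟩ := hT.eq_leaf (2 * j + 1) (by omega) (by omega)
  rw [ha, hb, better_congr (h a) (h b)]

end Tournament

/-! ### Weakest preconditions for programs with step counts -/

section Machine

variable {M W : ℕ}

/-- Started in `σ`, the program `p` halts within the bounds, in a configuration and after a number
of steps that satisfy `Q`. -/
def Wp (M W : ℕ) (p : Prog) (σ : State) (Q : State → ℕ → Prop) : Prop :=
  ∃ t σ', Exec M W p σ t σ' ∧ Q σ' t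

/-- Write an integer register. -/
def State.putN (σ : State) (x k : ℕ) : State :=
  { σ with nreg := Function.update σ.nreg x k }

/-- Write a cell of an integer array. -/
def State.storeN (σ : State) (a i k : ℕ) : State :=
  { σ with nmem := Function.update σ.nmem a (Function.update (σ.nmem a) i k) }

/-- Write a cell of a real array. -/
def State.storeR (σ : State) (a i : ℕ) (r : ℝ) : State :=
  { σ with rmem := Function.update σ.rmem a (Function.update (σ.rmem a) i r) }

section Access

variable (σ : State) (x a i k b y : ℕ) (r : ℝ)

@[simp] theorem putN_nreg : (σ.putN x k).nreg y = if y = x then k else σ.nreg y := by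
  simp [State.putN, Function.update_apply]
@[simp] theorem putN_rreg : (σ.putN x k).rreg = σ.rreg := rfl
@[simp] theorem putN_nmem : (σ.putN x k).nmem = σ.nmem := rfl
@[simp] theorem putN_rmem : (σ.putN x k).rmem = σ.rmem := rfl
@[simp] theorem setR_nreg : (σ.setR x r).nreg = σ.nreg := rfl
@[simp] theorem setR_rreg : (σ.setR x r).rreg y = if y = x then r else σ.rreg y := by
  simp [State.setR, Function.update_apply]
@[simp] theorem setR_nmem : (σ.setR x r).nmem = σ.nmem := rfl
@[simp] theorem setR_rmem : (σ.setR x r).rmem = σ.rmem := rfl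
@[simp] theorem storeN_nreg : (σ.storeN a i k).nreg = σ.nreg := rfl
@[simp] theorem storeN_rreg : (σ.storeN a i k).rreg = σ.rreg := rfl
@[simp] theorem storeN_nmem :
    (σ.storeN a i k).nmem b = if b = a then Function.update (σ.nmem a) i k else σ.nmem b := by
  simp [State.storeN, Function.update_apply]
@[simp] theorem storeN_rmem : (σ.storeN a i k).rmem = σ.rmem := rfl
@[simp] theorem storeR_nreg : (σ.storeR a i r).nreg = σ.nreg := rfl
@[simp] theorem storeR_rreg : (σ.storeR a i r).rreg = σ.rreg := rfl
@[simp] theorem storeR_nmem : (σ.storeR a i r).nmem = σ.nmem := rfl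
@[simp] theorem storeR_rmem :
    (σ.storeR a i r).rmem b = if b = a then Function.update (σ.rmem a) i r else σ.rmem b := by
  simp [State.storeR, Function.update_apply]

end Access

variable {σ : State} {Q Q' : State → ℕ → Prop}

theorem Wp.mono {p : Prog} (h : Wp M W p σ Q) (hQ : ∀ σ' t, Q σ' t → Q' σ' t) : Wp M W p σ Q' := by
  obtain ⟨t, σ', he, hq⟩ := h
  exact ⟨t, σ', he, hQ _ _ hq⟩

/-- This rule and those for the other constructs except loops are equivalences, so `simp only` can
execute loop-free code symbolically and leave the bounds on words and addresses as goals. -/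
theorem wp_skip : Wp M W .skip σ Q ↔ Q σ 0 := by
  constructor
  · rintro ⟨t, σ', h, hq⟩
    cases h
    exact hq
  · exact fun h => ⟨_, _, .skip σ, h⟩

theorem wp_seq {p q : Prog} :
    Wp M W (.seq p q) σ Q ↔ Wp M W p σ fun σ' t => Wp M W q σ' fun σ'' t' => Q σ'' (t + t') := by
  constructor
  · rintro ⟨t, σ', h, hq⟩
    cases h with
    | seq h1 h2 => exact ⟨_, _, h1, _, _, h2, hq⟩
  · rintro ⟨t, σ', h, t', σ'', h', hq⟩
    exact ⟨_, _, .seq h h', hq⟩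

theorem wp_ite {b : Test} {p q : Prog} :
    Wp M W (.ite b p q) σ Q ↔ (b.Holds σ → Wp M W p σ fun σ' t => Q σ' (t + 1)) ∧
      (¬ b.Holds σ → Wp M W q σ fun σ' t => Q σ' (t + 1)) := by
  constructor
  · rintro ⟨t, σ', h, hq⟩
    cases h with
    | ite_true hb h => exact ⟨fun _ => ⟨_, _, h, hq⟩, fun h => absurd hb h⟩
    | ite_false hb h => exact ⟨fun h => absurd h hb, fun _ => ⟨_, _, h, hq⟩⟩
  · rintro ⟨h1, h2⟩
    by_cases hb : b.Holds σ
    · obtain ⟨t, σ', h, hq⟩ := h1 hb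
      exact ⟨_, _, .ite_true hb h, hq⟩
    · obtain ⟨t, σ', h, hq⟩ := h2 hb
      exact ⟨_, _, .ite_false hb h, hq⟩

/-- The rule for loops: `I B` is an invariant with a bound `B` for the number of steps left. -/
theorem wp_loop {b : Test} {p : Prog} (I : ℕ → State → Prop)
    (hstep : ∀ B σ, I B σ → b.Holds σ →
      Wp M W p σ fun σ' t => ∃ B', t + 1 + B' ≤ B ∧ I B' σ')
    (hend : ∀ B σ, I B σ → 1 ≤ B) (B : ℕ) (σ : State) (h : I B σ) :
    Wp M W (.loop b p) σ fun σ' t => t ≤ B ∧ ¬ b.Holds σ' ∧ ∃ B', I B' σ' := by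
  induction B using Nat.strong_induction_on generalizing σ with
  | _ B ih =>
    by_cases hb : b.Holds σ
    · obtain ⟨t, σ', he, B', hB', hI⟩ := hstep B σ h hb
      obtain ⟨t', σ'', he', ht', hq⟩ := ih B' (by omega) σ' hI
      exact ⟨_, _, .loop_true hb he he', by omega, hq⟩
    · exact ⟨_, _, .loop_false hb, hend B σ h, hb, B, h⟩

theorem wp_instr {i : Instr} : Wp M W (.instr i) σ Q ↔ ∃ σ', i.exec M W σ = some σ' ∧ Q σ' 1 := by
  constructor
  · rintro ⟨t, σ', h, hq⟩
    cases h with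
    | instr h => exact ⟨_, h, hq⟩
  · rintro ⟨σ', h, hq⟩
    exact ⟨_, _, .instr h, hq⟩

theorem setN_eq_some {x k : ℕ} {σ' : State} :
    σ.setN W x k = some σ' ↔ k < W ∧ σ.putN x k = σ' := by
  unfold State.setN State.putN
  split_ifs with h <;> simp [h]

variable {x y z k a : ℕ}

theorem wp_const : Wp M W (.instr (.const x k)) σ Q ↔ k < W ∧ Q (σ.putN x k) 1 := by
  simp [wp_instr, Instr.exec, setN_eq_some, and_assoc]

theorem wp_copy :
    Wp M W (.instr (.copy x y)) σ Q ↔ σ.nreg y < W ∧ Q (σ.putN x (σ.nreg y)) 1 := by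
  simp [wp_instr, Instr.exec, setN_eq_some, and_assoc]

theorem wp_add : Wp M W (.instr (.add x y z)) σ Q ↔
    σ.nreg y + σ.nreg z < W ∧ Q (σ.putN x (σ.nreg y + σ.nreg z)) 1 := by
  simp [wp_instr, Instr.exec, setN_eq_some, and_assoc]

theorem wp_sub : Wp M W (.instr (.sub x y z)) σ Q ↔
    σ.nreg y - σ.nreg z < W ∧ Q (σ.putN x (σ.nreg y - σ.nreg z)) 1 := by
  simp [wp_instr, Instr.exec, setN_eq_some, and_assoc]

theorem wp_half : Wp M W (.instr (.half x y)) σ Q ↔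
    σ.nreg y / 2 < W ∧ Q (σ.putN x (σ.nreg y / 2)) 1 := by
  simp [wp_instr, Instr.exec, setN_eq_some, and_assoc]

theorem wp_load : Wp M W (.instr (.load x a y)) σ Q ↔ σ.nreg y < M ∧
    σ.nmem a (σ.nreg y) < W ∧ Q (σ.putN x (σ.nmem a (σ.nreg y))) 1 := by
  by_cases h : σ.nreg y < M <;> simp [wp_instr, Instr.exec, setN_eq_some, and_assoc, h]

theorem wp_store : Wp M W (.instr (.store a y x)) σ Q ↔
    σ.nreg y < M ∧ Q (σ.storeN a (σ.nreg y) (σ.nreg x)) 1 := by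
  by_cases h : σ.nreg y < M <;> simp [wp_instr, Instr.exec, State.storeN, h]

theorem wp_radd : Wp M W (.instr (.radd x y z)) σ Q ↔
    Q (σ.setR x (σ.rreg y + σ.rreg z)) 1 := by
  simp [wp_instr, Instr.exec]

theorem wp_rload : Wp M W (.instr (.rload x a y)) σ Q ↔
    σ.nreg y < M ∧ Q (σ.setR x (σ.rmem a (σ.nreg y))) 1 := by
  by_cases h : σ.nreg y < M <;> simp [wp_instr, Instr.exec, h]

theorem wp_rstore : Wp M W (.instr (.rstore a y x)) σ Q ↔
    σ.nreg y < M ∧ Q (σ.storeR a (σ.nreg y) (σ.rreg x)) 1 := by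
  by_cases h : σ.nreg y < M <;> simp [wp_instr, Instr.exec, State.storeR, h]

end Machine

/-! ### The program -/

section Program

/-- Sequential composition of a list of programs. -/
def seqs : List Prog → Prog
  | [] => .skip
  | p :: ps => .seq p (seqs ps)

/-- Go to the parent in the tree and recompute it. -/
def walkStep : Prog := seqs
  [.instr (.half 10 10),
   .instr (.add 11 10 10),
   .instr (.load 12 7 11),
   .instr (.add 11 11 5),
   .instr (.load 16 7 11),
   .ite (.eq 12 4) (.instr (.copy 12 16))
    (.ite (.eq 16 4) .skip (seqs
      [.instr (.rload 0 1 12),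
       .instr (.rload 1 1 16),
       .ite (.rlt 1 0) (.instr (.copy 12 16)) .skip])),
   .instr (.store 7 10 12)]

/-- Change the leaf of the tree that is given by register `10` to register `17`, and recompute the
nodes above. -/
def walkProg : Prog := .seq (.instr (.store 7 10 17)) (.loop (.lt 5 10) walkStep)

/-- Relax the edge before register `8`. -/
def relaxProg : Prog := seqs
  [.instr (.sub 11 8 5),
   .instr (.load 8 6 11),
   .instr (.load 12 1 11),
   .instr (.load 16 4 9),
   .instr (.add 10 0 12),
   .instr (.load 17 7 10),
   .instr (.load 18 8 12),
   .ite (.lt 16 6)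
    (.ite (.eq 18 6) .skip (seqs
      [.instr (.add 16 16 5),
       .instr (.rload 0 0 11),
       .instr (.rload 1 1 9),
       .instr (.radd 0 1 0),
       .instr (.store 2 7 12),
       .instr (.store 3 7 9),
       .instr (.store 4 7 16),
       .instr (.rstore 1 7 0),
       .ite (.eq 17 4) (.instr (.copy 17 7)) (seqs
        [.instr (.rload 1 1 17),
         .ite (.rlt 0 1) (.instr (.copy 17 7)) .skip]),
       .instr (.add 7 7 5)]))
    .skip]

/-- Accept the record at the root of the tree. -/
def popProg : Prog := seqs
  [.instr (.copy 9 14),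
   .instr (.load 12 2 9),
   .instr (.store 8 12 6),
   .instr (.load 8 5 12),
   .instr (.add 10 0 12),
   .instr (.copy 17 4)]

/-- One step of a run: relax an edge of the current vertex, or accept a record. -/
def stepProg : Prog := seqs
  [.ite (.lt 4 8) relaxProg popProg,
   walkProg,
   .instr (.load 14 7 5),
   .instr (.add 15 8 14)]

/-- The run with the hop limit in register `6`, which is then doubled. -/
def scaleProg : Prog := seqs
  [.instr (.load 8 5 2),
   .instr (.copy 9 4),
   .instr (.store 8 2 6),
   .instr (.load 14 7 5),
   .instr (.add 15 8 14),
   .loop (.lt 4 15) stepProg,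
   .instr (.add 6 6 6)]

/-- Compute the adjacency lists. -/
def buildProg : Prog := .loop (.lt 10 1) (seqs
  [.instr (.load 11 0 10),
   .instr (.load 12 5 11),
   .instr (.store 6 10 12),
   .instr (.add 10 10 5),
   .instr (.store 5 11 10)])

/-- The whole algorithm. -/
def mainProg : Prog := seqs
  [.instr (.const 5 1),
   buildProg,
   .instr (.store 2 4 2),
   .instr (.copy 7 5),
   .instr (.copy 6 5),
   .instr (.add 13 0 0),
   .loop (.lt 6 13) scaleProg,
   .instr (.copy 0 7)]

end Program

/-! ### Updating a leaf of the tournament tree -/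

section Walk

variable {n M W q : ℕ} {wt : ℕ → ℝ} {σ : State}

theorem wp_walkStep {i : ℕ} (hM : 2 * n ≤ M) (hqM : q ≤ M) (hMW : M < W)
    (h4 : σ.nreg 4 = 0) (h5 : σ.nreg 5 = 1) (hi : σ.nreg 10 = i) (hi1 : 1 < i) (hi2 : i < 2 * n)
    (hq : ∀ j, 1 ≤ j → j < 2 * n → σ.nmem 7 j < q) :
    Wp M W walkStep σ fun σ' t => t ≤ 12 ∧ σ'.nreg 10 = i / 2 ∧
      σ'.rmem = σ.rmem ∧ (∀ x, x < 10 ∨ x = 13 ∨ x = 17 → σ'.nreg x = σ.nreg x) ∧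
      (∀ a, a ≠ 7 → σ'.nmem a = σ.nmem a) ∧
      σ'.nmem 7 = Function.update (σ.nmem 7) (i / 2) (better (σ.rmem 1)
        (σ.nmem 7 (2 * (i / 2))) (σ.nmem 7 (2 * (i / 2) + 1))) := by
  have e : i / 2 + i / 2 = 2 * (i / 2) := by omega
  have ha := hq (2 * (i / 2)) (by omega) (by omega)
  have hb := hq (2 * (i / 2) + 1) (by omega) (by omega)
  simp only [walkStep, seqs, wp_seq, wp_half, wp_add, wp_load, wp_ite, wp_copy, wp_skip, wp_rload, wp_store,
    Test.Holds, putN_nreg, putN_nmem, putN_rmem, setR_nreg, setR_nmem, setR_rreg,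
    setR_rmem, storeN_nreg, storeN_nmem, storeN_rmem, hi, h4, h5, e,
    reduceIte, Nat.reduceEqDiff, zero_ne_one]
  have hfr : ∀ x : ℕ, x < 10 ∨ x = 13 ∨ x = 17 → x ≠ 10 ∧ x ≠ 11 ∧ x ≠ 12 ∧ x ≠ 16 := by
    intro x hx; omega
  refine ⟨by omega, by omega, by omega, by omega, by omega, by omega, by omega, ?_, ?_⟩
  · intro h0
    refine ⟨by omega, by omega, by omega, trivial, trivial, ?_, ?_, ?_⟩
    · intro x hx
      obtain ⟨h1, h2, h3, h4⟩ := hfr x hx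
      simp [*]
    · intro a ha
      simp [ha]
    · simp [better, h0]
  · intro h0
    refine ⟨?_, ?_⟩
    · intro h0'
      refine ⟨by omega, by omega, trivial, trivial, ?_, ?_, ?_⟩
      · intro x hx
        obtain ⟨h1, h2, h3, h4⟩ := hfr x hx
        simp [*]
      · intro a ha
        simp [ha]
      · simp [better, h0, h0']
    · intro h0'
      refine ⟨by omega, by omega, ?_, ?_⟩
      · intro hlt
        refine ⟨by omega, by omega, by omega, trivial, trivial, ?_, ?_, ?_⟩
        · intro x hx
          obtain ⟨h1, h2, h3, h4⟩ := hfr x hx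
          simp [*]
        · intro a ha
          simp [ha]
        · simp [better, h0, h0', hlt]
      · intro hlt
        refine ⟨by omega, by omega, trivial, trivial, ?_, ?_, ?_⟩
        · intro x hx
          obtain ⟨h1, h2, h3, h4⟩ := hfr x hx
          simp [*]
        · intro a ha
          simp [ha]
        · simp [better, h0, h0', hlt]

/-- Only ancestors of the changed leaf can become wrong, and they are recomputed upwards. Each round
costs at most `12` steps and a test, and lowers `Nat.log 2 i` by one. -/
theorem wp_walk {ℓ : Fin n → ℕ} {v : Fin n} (hM : 2 * n ≤ M) (hqM : q ≤ M) (hMW : M < W)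
    (h4 : σ.nreg 4 = 0) (h5 : σ.nreg 5 = 1) (h10 : σ.nreg 10 = n + v)
    (hT : Tournament (σ.nmem 7) (σ.rmem 1) ℓ) (hℓ : ∀ v, ℓ v < q) (hx : σ.nreg 17 < q) :
    Wp M W walkProg σ fun σ' t => t ≤ 13 * Nat.log 2 (2 * n) + 2 ∧ σ'.rmem = σ.rmem ∧
      (∀ x, x < 10 ∨ x = 13 → σ'.nreg x = σ.nreg x) ∧
      (∀ a, a ≠ 7 → σ'.nmem a = σ.nmem a) ∧
      Tournament (σ'.nmem 7) (σ.rmem 1) (Function.update ℓ v (σ.nreg 17)) := by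
  rw [walkProg, wp_seq, wp_store, h10]
  refine ⟨by omega, ?_⟩
  refine (wp_loop (fun B σ' => ∃ i, σ'.nreg 10 = i ∧ 1 ≤ i ∧ i < 2 * n ∧
    B = 13 * Nat.log 2 i + 1 ∧ σ'.rmem = σ.rmem ∧
    (∀ x, x < 10 ∨ x = 13 ∨ x = 17 → σ'.nreg x = σ.nreg x) ∧
    (∀ a, a ≠ 7 → σ'.nmem a = σ.nmem a) ∧
    (∀ u : Fin n, σ'.nmem 7 (n + u) = Function.update ℓ v (σ.nreg 17) u) ∧
    -- Only the parent of the current node may be inconsistent. At `i = 1` this exception is the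
    -- node `0`, which is outside the tree.
    (∀ j, 1 ≤ j → j < n → j ≠ i / 2 → σ'.nmem 7 j =
      better (σ.rmem 1) (σ'.nmem 7 (2 * j)) (σ'.nmem 7 (2 * j + 1))) ∧
    ∀ j, 1 ≤ j → j < 2 * n → σ'.nmem 7 j < q) ?_ ?_ (13 * Nat.log 2 (n + v) + 1)
    (σ.storeN 7 (n + v) (σ.nreg 17))
    ⟨n + v, h10, by omega, by omega, rfl, rfl, fun _ _ => rfl, ?_, ?_, ?_, ?_⟩).mono ?_
  · rintro B σ₁ ⟨i, hi, hi1, hi2, rfl, hr, hn, hm, hleaf, hnode, hlt⟩ hb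
    have hb' : 1 < i := by
      simpa [Test.Holds, hi, hn 5, h5] using hb
    have hlog : Nat.log 2 i = Nat.log 2 (i / 2) + 1 := Nat.log_of_one_lt_of_le (by omega) hb'
    refine (wp_walkStep hM hqM hMW (by rw [hn 4 (by omega), h4]) (by rw [hn 5 (by omega), h5])
      hi hb' hi2 hlt).mono ?_
    rintro σ₂ t ⟨ht, k10, kr, kn, km, k7⟩
    refine ⟨13 * Nat.log 2 (i / 2) + 1, by omega, i / 2, k10, by omega, by omega, rfl,
      kr.trans hr, fun x hx => (kn x hx).trans (hn x hx), fun a ha => (km a ha).trans (hm a ha),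
      ?_, ?_, ?_⟩
    · intro u
      rw [k7, Function.update_of_ne (by omega), hleaf]
    · intro j hj1 hj2 hj3
      rw [k7]
      rw [Function.update_of_ne (a := 2 * j) (by omega),
        Function.update_of_ne (a := 2 * j + 1) (by omega)]
      rcases eq_or_ne j (i / 2) with rfl | hne
      · rw [Function.update_self, hr]
      · rw [Function.update_of_ne hne]
        exact hnode j hj1 hj2 hne
    · intro j hj1 hj2
      rw [k7]
      rcases eq_or_ne j (i / 2) with rfl | hne
      · rw [Function.update_self]
        rcases better_eq_or (σ₁.rmem 1) (σ₁.nmem 7 (2 * (i / 2))) (σ₁.nmem 7 (2 * (i / 2) + 1))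
          with h | h <;> rw [h] <;> exact hlt _ (by omega) (by omega)
      · rw [Function.update_of_ne hne]
        exact hlt j hj1 hj2
  · rintro B σ₁ ⟨i, -, -, -, rfl, -⟩
    omega
  · intro a ha
    simp [ha]
  · intro u
    simp only [storeN_nmem, reduceIte]
    rcases eq_or_ne u v with rfl | hne
    · simp
    · have : (u : ℕ) ≠ v := by simpa [Fin.ext_iff] using hne
      rw [Function.update_of_ne hne, Function.update_of_ne (by omega), hT.leaf]
  · intro j hj1 hj2 hj3
    simp only [storeN_nmem, reduceIte]
    rw [Function.update_of_ne (by omega), Function.update_of_ne (by omega),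
      Function.update_of_ne (by omega)]
    exact hT.node j hj1 hj2
  · intro j hj1 hj2
    simp only [storeN_nmem, reduceIte]
    rcases eq_or_ne j (n + v) with rfl | hne
    · rwa [Function.update_self]
    · rw [Function.update_of_ne hne]
      obtain ⟨u, hu⟩ := hT.eq_leaf j hj1 hj2
      rw [hu]
      exact hℓ u
  · rintro σ₁ t ⟨ht, hb, B, i, hi, hi1, hi2, -, hr, hn, hm, hleaf, hnode, hlt⟩
    have hb' : ¬ 1 < i := by
      simpa [Test.Holds, hi, hn 5, h5] using hb
    have hlog : Nat.log 2 (n + v) ≤ Nat.log 2 (2 * n) := Nat.log_mono_right (by omega)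
    refine ⟨by omega, hr, fun x hx => hn x (by omega), hm, hleaf, fun j hj1 hj2 => ?_⟩
    exact hnode j hj1 hj2 (by omega)

end Walk

/-! ### One step of a run on the machine -/

section Step

variable {n m M W : ℕ}

/-- The parts of a configuration that do not change during the runs. -/
structure Static (w : Fin n → Fin n → ℝ) (src dst : Fin m → Fin n) (s : Fin n) (σ : State) :
    Prop where
  reg0 : σ.nreg 0 = n
  reg1 : σ.nreg 1 = m
  reg2 : σ.nreg 2 = s
  reg4 : σ.nreg 4 = 0
  reg5 : σ.nreg 5 = 1
  reg13 : σ.nreg 13 = n + n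
  mem0 : ∀ i : Fin m, σ.nmem 0 i = src i
  mem1 : ∀ i : Fin m, σ.nmem 1 i = dst i
  weight : ∀ i : Fin m, σ.rmem 0 i = w (src i) (dst i)
  adj : Adjacency src (σ.nmem 5) (σ.nmem 6)

/-- The invariant of a run, apart from the tree. -/
structure Inner (G : Digraph (Fin n)) (w : Fin n → Fin n → ℝ) (src dst : Fin m → Fin n)
    (s : Fin n) (h K : ℕ) (S : Set (List (Fin n))) (σ : State) (P : ℕ → List (Fin n)) (u : Fin n)
    (ℓ A : Fin n → ℕ) : Prop where
  static : Static w src dst s σ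
  reg6 : σ.nreg 6 = h
  reg9 : σ.nreg 9 = A u
  records : Records G w s (σ.nreg 7) (σ.nmem 2) (σ.nmem 3) (σ.nmem 4) (σ.rmem 1) P
  scale : Scale w src dst s h (σ.nreg 7) (σ.nreg 8) (σ.nmem 2) (σ.nmem 4) (σ.nmem 8) (σ.rmem 1)
    u ℓ A
  bound : σ.nreg 7 + (unrelaxed src h (σ.nreg 8) (σ.nmem 8) u).card ≤ K
  done_le : ∀ v : Fin n, σ.nmem 8 v ≤ h
  lt : h < 2 * n
  old : ∀ p ∈ S, ∃ i < σ.nreg 7, P i = p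

/-- An upper bound for the number of steps left in a run. -/
def potential (src : Fin m → Fin n) (h : ℕ) (σ : State) (u : Fin n) : ℕ :=
  (unrelaxed src h (σ.nreg 8) (σ.nmem 8) u).card + (undone n h (σ.nmem 8)).card

/-- The invariant of a run before the tree is updated. -/
def Mid (G : Digraph (Fin n)) (w : Fin n → Fin n → ℝ) (src dst : Fin m → Fin n)
    (s : Fin n) (h K : ℕ) (S : Set (List (Fin n))) (φ : ℕ) (σ : State) : Prop :=
  ∃ (P : ℕ → List (Fin n)) (u : Fin n) (ℓ A : Fin n → ℕ) (v : Fin n),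
    Inner G w src dst s h K S σ P u (Function.update ℓ v (σ.nreg 17)) A ∧
    Tournament (σ.nmem 7) (σ.rmem 1) ℓ ∧ (∀ x, ℓ x < σ.nreg 7) ∧ σ.nreg 10 = n + v ∧
    potential src h σ u + 1 ≤ φ

/-- The invariant of a run. -/
def Loop (G : Digraph (Fin n)) (w : Fin n → Fin n → ℝ) (src dst : Fin m → Fin n)
    (s : Fin n) (h K : ℕ) (S : Set (List (Fin n))) (φ : ℕ) (σ : State) : Prop :=
  ∃ (P : ℕ → List (Fin n)) (u : Fin n) (ℓ A : Fin n → ℕ),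
    Inner G w src dst s h K S σ P u ℓ A ∧ Tournament (σ.nmem 7) (σ.rmem 1) ℓ ∧
    σ.nreg 14 = σ.nmem 7 1 ∧ σ.nreg 15 = σ.nreg 8 + σ.nreg 14 ∧ potential src h σ u ≤ φ

variable {G : Digraph (Fin n)} {w : Fin n → Fin n → ℝ} {src dst : Fin m → Fin n} {s : Fin n}
  {h K φ : ℕ} {S : Set (List (Fin n))} {σ σ' : State} {P : ℕ → List (Fin n)} {u : Fin n}
  {ℓ A : Fin n → ℕ}

theorem Static.congr (H : Static w src dst s σ) (hreg : ∀ x, x < 6 ∨ x = 13 → σ'.nreg x = σ.nreg x)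
    (hmem : ∀ a, a = 0 ∨ a = 1 ∨ a = 5 ∨ a = 6 → σ'.nmem a = σ.nmem a)
    (hr : σ'.rmem 0 = σ.rmem 0) : Static w src dst s σ' := by
  obtain ⟨h1, h2, h3, h4, h5, h6, h7, h8, h9, h10⟩ := H
  constructor <;> try first | rw [hreg _ (by omega)] | rw [hmem _ (by omega)] | rw [hr]
  all_goals try assumption
  rw [hmem _ (by omega)]
  assumption

theorem Inner.congr (H : Inner G w src dst s h K S σ P u ℓ A)
    (hreg : ∀ x, x < 10 ∨ x = 13 → σ'.nreg x = σ.nreg x)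
    (hmem : ∀ a, a ≠ 7 → σ'.nmem a = σ.nmem a) (hr : σ'.rmem = σ.rmem) :
    Inner G w src dst s h K S σ' P u ℓ A := by
  have hS := H.static.congr (σ' := σ') (fun x hx => hreg x (by omega))
    (fun a ha => hmem a (by omega)) (by rw [hr])
  obtain ⟨-, h2, h3, h4, h5, h6, h7, h8, h9⟩ := H
  refine ⟨hS, ?_, ?_, ?_, ?_, ?_, ?_, h8, ?_⟩ <;>
    simpa only [hr, hreg 6 (by omega), hreg 7 (by omega), hreg 8 (by omega), hreg 9 (by omega),
      hmem 2 (by omega), hmem 3 (by omega), hmem 4 (by omega), hmem 8 (by omega)]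

/-- Register `7` holds the number of records, `8` holds `cur`, `9` the accepted record of `u`.
Arrays `5`, `6`, `7`, `8` hold `head`, `next`, the tree and `done`. Each branch ends in one of two
ways, treated by `hskip` and `hpush`. -/
theorem wp_relax (hw : ∀ x y, G.Adj x y → 0 ≤ w x y) (hE : ∀ i, G.Adj (src i) (dst i))
    (hnM : 4 * n ≤ M) (hKM : K + m ≤ M) (hMW : M < W)
    (hI : Inner G w src dst s h K S σ P u ℓ A) (hT : Tournament (σ.nmem 7) (σ.rmem 1) ℓ)
    (hφ : potential src h σ u ≤ φ) (hcur : 0 < σ.nreg 8) :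
    Wp M W relaxProg σ fun σ' t => t ≤ 30 ∧ Mid G w src dst s h K S φ σ' := by
  have hS := hI.static
  have hsc := hI.scale
  have hadj := hS.adj
  obtain ⟨i, hi⟩ : ∃ i : Fin m, σ.nreg 8 = i + 1 :=
    ⟨⟨σ.nreg 8 - 1, by have := hsc.cur_le; omega⟩, by simp; omega⟩
  rw [hi] at hsc
  have hsrc : src i = u := hsc.cur_src i rfl
  have hAu := hsc.accepted u hsc.current
  have hq := hI.records.pos
  have hcard := unrelaxed_card_relax hadj hsrc hsc.current
  have hb := hI.bound
  rw [hi] at hb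
  unfold potential at hφ
  rw [hi] at hφ
  have hℓ : ∀ x, ℓ x < σ.nreg 7 := by
    intro x
    by_cases hx : ℓ x = 0
    · omega
    · exact (hsc.pending x hx).1
  have hℓi := hℓ (dst i)
  have hdone := hI.done_le (dst i)
  have hlt := hI.lt
  have hnext := hadj.next_le i
  have hw' : ∀ i, 0 ≤ w (src i) (dst i) := fun i => hw _ _ (hE i)
  have hadd : (i : ℕ) + 1 - 1 = i := by omega
  have hskip : ∀ σ', (σ.nmem 4 (A u) < h → σ.nmem 8 (dst i) = h) → σ'.rmem = σ.rmem →
      σ'.nmem = σ.nmem → (∀ x, x < 8 ∨ x = 9 ∨ x = 13 → σ'.nreg x = σ.nreg x) →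
      σ'.nreg 8 = σ.nmem 6 i → σ'.nreg 10 = n + dst i → σ'.nreg 17 = ℓ (dst i) →
      Mid G w src dst s h K S φ σ' := by
    intro σ' hc kr km kn k8 k10 k17
    refine ⟨P, u, ℓ, A, dst i, ?_, by rwa [km, kr], by rwa [kn 7 (by omega)], k10, ?_⟩
    -- A skipped edge writes its old value back to the leaf, so that the walk up the tree can follow
    -- in every case.
    · rw [k17, Function.update_eq_self]
      refine ⟨hS.congr (fun x hx => kn x (by omega)) (fun a _ => by rw [km]) (by rw [kr]),
        by rw [kn 6 (by omega), hI.reg6], by rw [kn 9 (by omega), hI.reg9], ?_, ?_, ?_, ?_, hlt, ?_⟩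
      · simpa only [kn 7 (by omega), km, kr] using hI.records
      · simpa only [kn 7 (by omega), k8, km, kr] using hsc.skip hw' hadj hc
      · rw [kn 7 (by omega), k8, km]
        omega
      · simpa only [km] using hI.done_le
      · simpa only [kn 7 (by omega)] using hI.old
    · unfold potential
      rw [k8, km]
      omega
  have hpush : ∀ σ', σ.nmem 4 (A u) < h → σ.nmem 8 (dst i) ≠ h → σ'.rmem 0 = σ.rmem 0 →
      σ'.rmem 1 = Function.update (σ.rmem 1) (σ.nreg 7) (σ.rmem 1 (A u) + w (src i) (dst i)) →
      σ'.nmem 2 = Function.update (σ.nmem 2) (σ.nreg 7) (dst i) →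
      σ'.nmem 3 = Function.update (σ.nmem 3) (σ.nreg 7) (A u) →
      σ'.nmem 4 = Function.update (σ.nmem 4) (σ.nreg 7) (σ.nmem 4 (A u) + 1) →
      (∀ a, a ≠ 2 → a ≠ 3 → a ≠ 4 → σ'.nmem a = σ.nmem a) →
      (∀ x, x < 7 ∨ x = 9 ∨ x = 13 → σ'.nreg x = σ.nreg x) → σ'.nreg 7 = σ.nreg 7 + 1 →
      σ'.nreg 8 = σ.nmem 6 i → σ'.nreg 10 = n + dst i →
      σ'.nreg 17 = better (σ'.rmem 1) (ℓ (dst i)) (σ.nreg 7) →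
      Mid G w src dst s h K S φ σ' := by
    intro σ' hc hd kr0 kr1 k2 k3 k4 km kn k7 k8 k10 k17
    have hrel := hsc.relax hw' hq hadj hc hd kr1
    refine ⟨Function.update P (σ.nreg 7) (P (A u) ++ [dst i]), u, ℓ, A, dst i, ?_, ?_, ?_, k10, ?_⟩
    · rw [k17]
      refine ⟨hS.congr (fun x hx => kn x (by omega))
        (fun a _ => by rw [km a (by omega) (by omega) (by omega)]) kr0,
        by rw [kn 6 (by omega), hI.reg6], by rw [kn 9 (by omega), hI.reg9], ?_, ?_, ?_, ?_, hlt, ?_⟩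
      · rw [k7, k2, k3, k4, kr1, hsrc]
        exact hI.records.push hAu.1 hAu.2.1 (hsrc ▸ hE i)
      · rwa [k7, k8, k2, k4, km 8 (by omega) (by omega) (by omega)]
      · rw [k7, k8, km 8 (by omega) (by omega) (by omega)]
        omega
      · simpa only [km 8 (by omega) (by omega) (by omega)] using hI.done_le
      · intro p hp
        obtain ⟨r, hr, rfl⟩ := hI.old p hp
        exact ⟨r, by omega, Function.update_of_ne hr.ne _ _⟩
    · rw [km 7 (by omega) (by omega) (by omega), kr1]
      exact hT.congr_weight fun v => Function.update_of_ne (hℓ v).ne _ _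
    · intro v
      have := hℓ v
      omega
    · unfold potential
      rw [k8, km 8 (by omega) (by omega) (by omega)]
      omega
  simp only [relaxProg, seqs, wp_seq, wp_half, wp_add, wp_sub, wp_load, wp_ite, wp_copy, wp_skip,
    wp_rload, wp_store, wp_radd, wp_rstore, Test.Holds, putN_nreg, putN_nmem, putN_rreg, putN_rmem,
    setR_nreg, setR_nmem, setR_rreg, setR_rmem, storeN_nreg, storeN_nmem, storeN_rmem, storeN_rreg,
    storeR_nreg, storeR_nmem, storeR_rmem, storeR_rreg, hi, hS.reg0, hS.reg4, hS.reg5, hI.reg6,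
    hI.reg9, hadd, hS.mem0, hS.mem1, hS.weight, hT.leaf,
    reduceIte, Nat.reduceEqDiff, zero_ne_one, OfNat.ofNat_ne_zero, OfNat.zero_ne_ofNat,
    OfNat.ofNat_ne_one, OfNat.one_ne_ofNat, one_ne_zero]
  refine ⟨by omega, by omega, by omega, by omega, by omega, by omega, by omega, by omega, by omega,
    by omega, by omega, by omega, ?_, ?_⟩
  · intro hc
    refine ⟨?_, ?_⟩
    · intro hd
      refine ⟨by omega, hskip _ (fun _ => hd) rfl rfl ?_ (by simp) (by simp) (by simp)⟩
      intro x hx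
      simp [show x ≠ 8 ∧ x ≠ 10 ∧ x ≠ 11 ∧ x ≠ 12 ∧ x ≠ 16 ∧ x ≠ 17 ∧ x ≠ 18 by omega]
    · intro hd
      refine ⟨by omega, by omega, by omega, by omega, by omega, by omega, by omega, ?_, ?_⟩
      · intro h0
        refine ⟨by omega, by omega, by omega, hpush _ hc hd (by simp) (by simp) (by simp)
          (by simp) (by simp) (fun a h2 h3 h4 => by simp [h2, h3, h4]) ?_ (by simp) (by simp)
          (by simp) (by simp [better, h0])⟩
        intro x hx
        simp [show x ≠ 7 ∧ x ≠ 8 ∧ x ≠ 10 ∧ x ≠ 11 ∧ x ≠ 12 ∧ x ≠ 16 ∧ x ≠ 17 ∧ x ≠ 18 by omega]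
      · intro h0
        refine ⟨by omega, ?_, ?_⟩
        · intro hc'
          refine ⟨by omega, by omega, by omega, hpush _ hc hd (by simp) (by simp) (by simp)
            (by simp) (by simp) (fun a h2 h3 h4 => by simp [h2, h3, h4]) ?_ (by simp) (by simp)
            (by simp) (by simp [better, h0, hq.ne', hc'])⟩
          intro x hx
          simp [show x ≠ 7 ∧ x ≠ 8 ∧ x ≠ 10 ∧ x ≠ 11 ∧ x ≠ 12 ∧ x ≠ 16 ∧ x ≠ 17 ∧ x ≠ 18 by omega]
        · intro hc'
          refine ⟨by omega, by omega, hpush _ hc hd (by simp) (by simp) (by simp)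
            (by simp) (by simp) (fun a h2 h3 h4 => by simp [h2, h3, h4]) ?_ (by simp) (by simp)
            (by simp) (by simp [better, h0, hq.ne', hc'])⟩
          intro x hx
          simp [show x ≠ 7 ∧ x ≠ 8 ∧ x ≠ 10 ∧ x ≠ 11 ∧ x ≠ 12 ∧ x ≠ 16 ∧ x ≠ 17 ∧ x ≠ 18 by omega]
  · intro hc
    refine ⟨by omega, hskip _ (fun h => absurd h hc) rfl rfl ?_ (by simp) (by simp) (by simp)⟩
    intro x hx
    simp [show x ≠ 8 ∧ x ≠ 10 ∧ x ≠ 11 ∧ x ≠ 12 ∧ x ≠ 16 ∧ x ≠ 17 ∧ x ≠ 18 by omega]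

/-- The root holds a lightest pending record. Its leaf is to be emptied, so register `17` becomes
`0`; the potential falls because one more vertex is accepted. -/
theorem wp_pop (hnM : 4 * n ≤ M) (hKM : K + m ≤ M) (hMW : M < W)
    (hI : Inner G w src dst s h K S σ P u ℓ A) (hT : Tournament (σ.nmem 7) (σ.rmem 1) ℓ)
    (h14 : σ.nreg 14 = σ.nmem 7 1) (hφ : potential src h σ u ≤ φ) (hcur : σ.nreg 8 = 0)
    (hroot : σ.nmem 7 1 ≠ 0) :
    Wp M W popProg σ fun σ' t => t ≤ 30 ∧ Mid G w src dst s h K S φ σ' := by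
  have hS := hI.static
  have hsc := hI.scale
  have hadj := hS.adj
  rw [hcur] at hsc
  have hq := hI.records.pos
  obtain ⟨v, hv⟩ := hT.eq_leaf 1 le_rfl (by have := s.2; omega)
  have hv0 : ℓ v ≠ 0 := hv ▸ hroot
  have hmin : ∀ x, ℓ x ≠ 0 → σ.rmem 1 (ℓ v) ≤ σ.rmem 1 (ℓ x) := by
    intro x hx
    rw [← hv, ← hT.leaf x]
    exact (hT.root_le (n + x) (by omega) (by omega) (by rwa [hT.leaf])).2
  obtain ⟨hvq, hvv, -, hvd⟩ := hsc.pending v hv0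
  have hpop := hsc.pop hadj hv0 hmin
  have hb := hI.bound
  have hcard := unrelaxed_card_pop (src := src) (u := u) (σ.nmem 5 v) hvd
  have hcard' := undone_card_pop hvd
  rw [hcur] at hb
  unfold potential at hφ
  rw [hcur] at hφ
  have hℓ : ∀ x, ℓ x < σ.nreg 7 := by
    intro x
    by_cases hx : ℓ x = 0
    · omega
    · exact (hsc.pending x hx).1
  have hlt := hI.lt
  have hhead := hadj.head_le v
  simp only [popProg, seqs, wp_seq, wp_add, wp_load, wp_copy, wp_skip, wp_store, putN_nreg,
    putN_nmem, putN_rreg, putN_rmem, storeN_nreg, storeN_nmem, storeN_rmem, hS.reg0, hS.reg4,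
    hI.reg6, h14, hv, hvv, reduceIte, Nat.reduceEqDiff, OfNat.ofNat_ne_zero, OfNat.zero_ne_ofNat]
  refine ⟨by omega, by omega, by omega, by omega, by omega, by omega, by omega, by omega, by omega,
    P, v, ℓ, Function.update A v (ℓ v), v, ?_, by simpa using hT, by simpa using hℓ, by simp, ?_⟩
  · refine ⟨hS.congr ?_ ?_ (by simp), by simp [hI.reg6], by simp, by simpa using hI.records,
      by simpa using hpop, ?_, ?_, hlt, by simpa using hI.old⟩
    · intro x hx
      simp [show x ≠ 8 ∧ x ≠ 9 ∧ x ≠ 10 ∧ x ≠ 12 ∧ x ≠ 17 by omega]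
    · intro a ha
      simp [show a ≠ 8 by omega]
    · simp
      omega
    · intro x
      simp only [putN_nmem, storeN_nmem, reduceIte, Function.update_apply]
      split_ifs
      · rfl
      · exact hI.done_le x
  · simp [potential]
    omega

theorem wp_step (hw : ∀ x y, G.Adj x y → 0 ≤ w x y) (hE : ∀ i, G.Adj (src i) (dst i))
    (hnM : 4 * n ≤ M) (hKM : K + m ≤ M) (hMW : M < W)
    (hL : Loop G w src dst s h K S φ σ) (hgo : 0 < σ.nreg 15) :
    Wp M W stepProg σ fun σ' t => t ≤ 13 * Nat.log 2 (2 * n) + 36 ∧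
      ∃ φ', φ' + 1 ≤ φ ∧ Loop G w src dst s h K S φ' σ' := by
  obtain ⟨P, u, ℓ, A, hI, hT, h14, h15, hφ⟩ := hL
  have hfirst : Wp M W (.ite (.lt 4 8) relaxProg popProg) σ fun σ' t =>
      t ≤ 31 ∧ Mid G w src dst s h K S φ σ' := by
    rw [wp_ite]
    simp only [Test.Holds, hI.static.reg4]
    refine ⟨fun hc => ?_, fun hc => ?_⟩
    · refine (wp_relax hw hE hnM hKM hMW hI hT hφ hc).mono fun σ' t ht => ⟨by omega, ht.2⟩
    · refine (wp_pop hnM hKM hMW hI hT h14 hφ (by omega) (by omega)).mono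
        fun σ' t ht => ⟨by omega, ht.2⟩
  rw [stepProg, seqs, wp_seq]
  refine hfirst.mono ?_
  rintro σ₁ t₁ ⟨ht₁, P', u', ℓ', A', v, hI', hT', hℓ', h10', hφ'⟩
  have hbound := hI'.bound
  have hq' := hI'.records.pos
  have hn := s.2
  have hx : σ₁.nreg 17 < σ₁.nreg 7 := by
    by_cases h0 : σ₁.nreg 17 = 0
    · omega
    · have := (hI'.scale.pending v (by simpa using h0)).1
      simpa using this
  rw [seqs, wp_seq]
  refine (wp_walk (by omega) (show σ₁.nreg 7 ≤ M by omega) hMW hI'.static.reg4 hI'.static.reg5 h10'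
    hT' hℓ' hx).mono ?_
  rintro σ₂ t₂ ⟨ht₂, kr, kn, km, hT₂⟩
  have hI₂ := hI'.congr kn km kr
  have hcur := hI₂.scale.cur_le
  have hT1 : σ₂.nmem 7 1 < σ₁.nreg 7 := by
    obtain ⟨y, hy⟩ := hT₂.eq_leaf 1 le_rfl (by omega)
    rw [hy, Function.update_apply]
    split_ifs
    · exact hx
    · exact hℓ' y
  simp only [seqs, wp_seq, wp_load, wp_add, wp_skip, putN_nreg, putN_nmem, hI₂.static.reg5,
    reduceIte, Nat.reduceEqDiff]
  refine ⟨by omega, by omega, by omega, by omega, potential src h σ₁ u', hφ', P', u', _, A',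
    hI₂.congr ?_ (by simp) (by simp), by simpa [kr] using hT₂, by simp, by simp, ?_⟩
  · intro x hx
    simp [show x ≠ 14 ∧ x ≠ 15 by omega]
  · simp [potential, kn 8 (by omega), km 8 (by omega)]

end Step

/-! ### A complete run and the invariant between runs -/

section Scales

variable {n m M W : ℕ}

/-- The paths that the runs with the hop limits `2 ^ i`, `i < j`, have to find. -/
def targets (G : Digraph (Fin n)) (w : Fin n → Fin n → ℝ) (s : Fin n) (j : ℕ) :
    Set (List (Fin n)) :=
  {p | ∃ i < j, ∃ v, IsHopShortest G w (2 ^ i + hop p) s v p ∧ hop p ≤ 2 ^ i}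

/-- The invariant between the runs. -/
structure Outer (G : Digraph (Fin n)) (w : Fin n → Fin n → ℝ) (src dst : Fin m → Fin n)
    (s : Fin n) (j : ℕ) (σ : State) (P : ℕ → List (Fin n)) : Prop where
  static : Static w src dst s σ
  reg6 : σ.nreg 6 = 2 ^ j
  records : Records G w s (σ.nreg 7) (σ.nmem 2) (σ.nmem 3) (σ.nmem 4) (σ.rmem 1) P
  bound : σ.nreg 7 ≤ 1 + j * m
  tree : Tournament (n := n) (σ.nmem 7) (σ.rmem 1) fun _ => 0
  done_lt : ∀ v : Fin n, σ.nmem 8 v < 2 ^ j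
  old : ∀ p ∈ targets G w s j, ∃ i < σ.nreg 7, P i = p

variable {G : Digraph (Fin n)} {w : Fin n → Fin n → ℝ} {src dst : Fin m → Fin n} {s : Fin n}
  {j : ℕ} {σ : State} {P : ℕ → List (Fin n)}

/-- The potential starts at most at `m + n` and falls with every step. Each step adds at most one
record and then uses up an edge, so a run adds at most `m` records. -/
theorem wp_scale (hw : ∀ x y, G.Adj x y → 0 ≤ w x y) (hu : UniqueHopShortest G w)
    (hE : ∀ i, G.Adj (src i) (dst i)) (hE' : ∀ x y, G.Adj x y → ∃ i, src i = x ∧ dst i = y)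
    (hnM : 4 * n ≤ M) (hKM : 1 + (j + 1) * m + m ≤ M) (hMW : M < W)
    (hO : Outer G w src dst s j σ P) (hj : 2 ^ j < 2 * n) :
    Wp M W scaleProg σ fun σ' t => t ≤ (m + n) * (13 * Nat.log 2 (2 * n) + 37) + 8 ∧
      ∃ P', Outer G w src dst s (j + 1) σ' P' := by
  have hS := hO.static
  have hn := s.2
  have hhead := hS.adj.head_le s
  have hT1 : σ.nmem 7 1 = 0 := by
    obtain ⟨y, hy⟩ := hO.tree.eq_leaf 1 le_rfl (by omega)
    exact hy
  have hinit := Scale.init (w := w) (dst := dst) (wt := σ.rmem 1) hS.adj hO.records.pos hO.done_lt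
    hO.records.vert_zero hO.records.hp_zero
  simp only [scaleProg, seqs, wp_seq (q := .seq _ _), wp_add, wp_load, wp_copy, wp_store, putN_nreg,
    putN_nmem, putN_rreg, putN_rmem, storeN_nreg, storeN_nmem, storeN_rmem, hS.reg2, hS.reg4,
    hS.reg5, hO.reg6, hT1, reduceIte, Nat.reduceEqDiff, OfNat.ofNat_ne_zero, OfNat.zero_ne_ofNat]
  refine ⟨by omega, by omega, by omega, by omega, by omega, by omega, by omega, ?_⟩
  set σ₁ := ((((σ.putN 8 (σ.nmem 5 s)).putN 9 0).storeN 8 s (2 ^ j)).putN 14 0).putN 15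
    (σ.nmem 5 s + 0) with hσ₁
  have hstart : Loop G w src dst s (2 ^ j) (1 + (j + 1) * m) (targets G w s j) (m + n) σ₁ := by
    have hc1 : (unrelaxed src (2 ^ j) (σ₁.nreg 8) (σ₁.nmem 8) s).card ≤ m :=
      (Finset.card_le_univ _).trans (by simp)
    have hc2 : (undone n (2 ^ j) (σ₁.nmem 8)).card ≤ n :=
      (Finset.card_le_univ _).trans (by simp)
    refine ⟨P, s, fun _ => 0, fun _ => 0, ?_, by simpa [hσ₁] using hO.tree, by simp [hσ₁, hT1],
      by simp [hσ₁], by unfold potential; omega⟩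
    refine ⟨hS.congr ?_ ?_ (by simp [hσ₁]), by simp [hσ₁, hO.reg6], by simp [hσ₁],
      by simpa [hσ₁] using hO.records, by simpa [hσ₁] using hinit, ?_, ?_, hj,
      by simpa [hσ₁] using hO.old⟩
    · intro x hx
      simp [hσ₁, show x ≠ 8 ∧ x ≠ 9 ∧ x ≠ 14 ∧ x ≠ 15 by omega]
    · intro a ha
      simp [hσ₁, show a ≠ 8 by omega]
    · have h7 : σ₁.nreg 7 = σ.nreg 7 := by simp [hσ₁]
      have := hO.bound
      rw [h7]
      linarith
    · intro x
      simp only [hσ₁, putN_nmem, storeN_nmem, reduceIte, Function.update_apply]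
      split_ifs
      · rfl
      · exact (hO.done_lt x).le
  refine (wp_loop (fun B σ' => ∃ φ, B = φ * (13 * Nat.log 2 (2 * n) + 37) + 1 ∧
    Loop G w src dst s (2 ^ j) (1 + (j + 1) * m) (targets G w s j) φ σ') ?_ ?_ _ _
    ⟨_, rfl, hstart⟩).mono ?_
  · rintro B σ₂ ⟨φ, rfl, hL⟩ hb
    have hb' : 0 < σ₂.nreg 15 := by
      obtain ⟨_, _, _, _, hI, -⟩ := hL
      simpa [Test.Holds, hI.static.reg4] using hb
    refine (wp_step hw hE hnM hKM hMW hL hb').mono ?_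
    rintro σ₃ t ⟨ht, φ', hφ', hL'⟩
    refine ⟨_, ?_, φ', rfl, hL'⟩
    have := Nat.mul_le_mul_right (13 * Nat.log 2 (2 * n) + 37) hφ'
    rw [add_mul] at this
    omega
  · rintro B σ₂ ⟨φ, rfl, -⟩
    omega
  · rintro σ₂ t ⟨ht, hb, B, φ, -, P', u, ℓ, A, hI, hT, h14, h15, -⟩
    have hS' := hI.static
    have hb' : σ₂.nreg 15 = 0 := by
      simpa [Test.Holds, hS'.reg4] using hb
    -- Register `15` is the sum of `cur` and the root, so a single test tells whether both vanish.
    have hcur : σ₂.nreg 8 = 0 := by omega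
    have hroot : σ₂.nmem 7 1 = 0 := by omega
    have hℓ : ∀ v, ℓ v = 0 := by
      intro v
      by_contra h0
      rw [← hT.leaf] at h0
      exact (hT.root_le (n + v) (by omega) (by omega) h0).1 hroot
    have hsc := hI.scale
    rw [hcur] at hsc
    have hbound := hI.bound
    have hpow : 2 ^ j + 2 ^ j = 2 ^ (j + 1) := by ring
    have hpos : 0 < 2 ^ j := by positivity
    simp only [seqs, wp_seq, wp_add, wp_skip, hI.reg6]
    refine ⟨by omega, by omega, P', hS'.congr ?_ (by simp) (by simp), by simp [hpow],
      by simpa using hI.records, by simp; omega, ?_, ?_, ?_⟩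
    · intro x hx
      simp only [putN_nreg]
      split_ifs with h
      · omega
      · rfl
    -- The run leaves the tree empty, as the next run requires.
    · rw [funext hℓ] at hT
      simpa using hT
    · intro v
      have := hI.done_le v
      simp
      omega
    · rintro p ⟨i, hi, v, hp, hph⟩
      simp only [putN_nreg, Nat.reduceEqDiff, reduceIte]
      rcases Nat.lt_succ_iff_lt_or_eq.1 hi with h | rfl
      · exact hI.old p ⟨i, h, v, hp, hph⟩
      · obtain ⟨h1, h2⟩ := hsc.finish hu hE' hℓ hI.records hp hph
        exact ⟨_, (hsc.accepted v h1).1, h2⟩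

end Scales

/-! ### Construction of the adjacency lists -/

section Build

variable {n m M W : ℕ}

/-- Adjacency lists of the first `k` edges. -/
structure PartialAdjacency (src : Fin m → Fin n) (k : ℕ) (head next : ℕ → ℕ) : Prop where
  head_le : ∀ v : Fin n, head v ≤ k
  head_src : ∀ (v : Fin n) (i : Fin m), head v = i + 1 → src i = v
  lt_head : ∀ i : Fin m, i < k → (i : ℕ) < head (src i)
  next_le : ∀ i : Fin m, i < k → next i ≤ i
  next_src : ∀ i j : Fin m, i < k → next i = j + 1 → src j = src i
  lt_next : ∀ i j : Fin m, i < k → j < i → src j = src i → (j : ℕ) < next i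

variable {src : Fin m → Fin n} {head next : ℕ → ℕ} {σ : State}

theorem PartialAdjacency.adjacency (h : PartialAdjacency src m head next) :
    Adjacency src head next :=
  ⟨h.head_le, h.head_src, fun i => h.lt_head i i.2, fun i => h.next_le i i.2,
    fun i j => h.next_src i j i.2, fun i j => h.lt_next i j i.2⟩

/-- Edge `i` is put in front of the list of its tail. Edges arrive in increasing order, so each list
is decreasing and the old head bounds all earlier edges with the same tail. -/
theorem PartialAdjacency.snoc {i : Fin m} (h : PartialAdjacency src i head next) :
    PartialAdjacency src (i + 1) (Function.update head (src i) (i + 1))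
      (Function.update next i (head (src i))) := by
  have hne : ∀ j : Fin m, (j : ℕ) < i + 1 → j ≠ i → (j : ℕ) < i := by
    intro j hj hji
    have : (j : ℕ) ≠ i := by simpa [Fin.ext_iff] using hji
    omega
  have hupd : ∀ j : Fin m, j ≠ i → Function.update next i (head (src i)) j = next j := by
    intro j hj
    rw [Function.update_of_ne (by simpa [Fin.ext_iff] using hj)]
  refine ⟨?_, ?_, ?_, ?_, ?_, ?_⟩
  · intro v
    rw [Function.update_apply]
    split_ifs
    · rfl
    · exact (h.head_le v).trans (Nat.le_succ _)
  · intro v j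
    rw [Function.update_apply]
    split_ifs with hv
    · intro hj
      obtain rfl : i = j := Fin.ext (by omega)
      exact Fin.ext hv.symm
    · exact h.head_src v j
  · intro j hj
    rw [Function.update_apply]
    split_ifs with hv
    · exact hj
    · exact h.lt_head j (hne j hj (by rintro rfl; exact hv rfl))
  · intro j hj
    rcases eq_or_ne j i with rfl | hji
    · simpa using h.head_le (src j)
    · rw [hupd j hji]
      exact h.next_le j (hne j hj hji)
  · intro j k hj
    rcases eq_or_ne j i with rfl | hji
    · simpa using h.head_src (src j) k
    · rw [hupd j hji]
      exact h.next_src j k (hne j hj hji)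
  · intro j k hj hkj hs
    rcases eq_or_ne j i with rfl | hji
    · rw [Function.update_self, ← hs]
      exact h.lt_head k hkj
    · rw [hupd j hji]
      exact h.lt_next j k (hne j hj hji) hkj hs

theorem wp_build (hnM : n ≤ M) (hmM : m + 1 ≤ M) (hMW : M < W) (h1 : σ.nreg 1 = m)
    (h5 : σ.nreg 5 = 1) (h10 : σ.nreg 10 = 0) (hsrc : ∀ i : Fin m, σ.nmem 0 i = src i)
    (hhead : ∀ i, σ.nmem 5 i = 0) :
    Wp M W buildProg σ fun σ' t => t ≤ 6 * m + 1 ∧ Adjacency src (σ'.nmem 5) (σ'.nmem 6) ∧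
      (∀ x, x ≠ 10 → x ≠ 11 → x ≠ 12 → σ'.nreg x = σ.nreg x) ∧
      (∀ a, a ≠ 5 → a ≠ 6 → σ'.nmem a = σ.nmem a) ∧ σ'.rmem = σ.rmem := by
  refine (wp_loop (fun B σ' => ∃ k, k ≤ m ∧ B = 6 * (m - k) + 1 ∧ σ'.nreg 10 = k ∧
    PartialAdjacency src k (σ'.nmem 5) (σ'.nmem 6) ∧
    (∀ x, x ≠ 10 → x ≠ 11 → x ≠ 12 → σ'.nreg x = σ.nreg x) ∧
    (∀ a, a ≠ 5 → a ≠ 6 → σ'.nmem a = σ.nmem a) ∧ σ'.rmem = σ.rmem) ?_ ?_ _ _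
    ⟨0, Nat.zero_le _, rfl, h10, ?_, fun _ _ _ _ => rfl, fun _ _ _ => rfl, rfl⟩).mono ?_
  · rintro B σ₁ ⟨k, hk, rfl, k10, hadj, kn, km, kr⟩ hb
    have hkm : k < m := by
      simpa [Test.Holds, k10, kn 1, h1] using hb
    obtain ⟨i, rfl⟩ : ∃ i : Fin m, k = i := ⟨⟨k, hkm⟩, rfl⟩
    have hle := hadj.head_le (src i)
    simp only [seqs, wp_seq, wp_add, wp_load, wp_skip, wp_store, putN_nreg, putN_nmem, putN_rreg,
      putN_rmem, storeN_nreg, storeN_nmem, storeN_rmem, k10, km 0 (by omega) (by omega), hsrc,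
      kn 5 (by omega) (by omega) (by omega), h5, reduceIte, Nat.reduceEqDiff]
    refine ⟨by omega, by omega, by omega, by omega, by omega, by omega, by omega,
      6 * (m - (i + 1)) + 1, by omega, i + 1, by omega, rfl, rfl, hadj.snoc, ?_, ?_, kr⟩
    · intro x hx1 hx2 hx3
      simp [hx1, hx2, hx3, kn x hx1 hx2 hx3]
    · intro a ha1 ha2
      simp [ha1, ha2, km a ha1 ha2]
  · rintro B σ₁ ⟨k, -, rfl, -⟩
    omega
  · exact ⟨by simp [hhead], by simp [hhead], by simp, by simp, by simp, by simp⟩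
  · rintro σ₁ t ⟨ht, hb, B, k, hk, -, k10, hadj, kn, km, kr⟩
    have hkm : ¬ k < m := by
      simpa [Test.Holds, k10, kn 1, h1] using hb
    obtain rfl : k = m := by omega
    exact ⟨by omega, hadj.adjacency, kn, km, kr⟩

end Build

/-! ### Arithmetic of the time and space bounds -/

section Bounds

theorem log_add_one_le {N : ℕ} (hN : 0 < N) : Nat.log 2 N + 1 ≤ N :=
  Nat.succ_le_of_lt (Nat.log_lt_self 2 hN.ne')

theorem log_two_mul {n : ℕ} (hn : 0 < n) : Nat.log 2 (2 * n) = Nat.log 2 n + 1 := by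
  rw [mul_comm]
  exact Nat.log_mul_base one_lt_two hn.ne'

/-- Bounds the number of runs by `Nat.log 2 n + 2`. -/
theorem lt_log_add_two {n j : ℕ} (hj : 2 ^ j < 2 * n) : j < Nat.log 2 n + 2 := by
  have h := Nat.lt_pow_succ_log_self one_lt_two n
  have : 2 ^ j < 2 ^ (Nat.log 2 n + 2) := by
    rw [pow_succ 2 (Nat.log 2 n + 1)]
    omega
  exact (Nat.pow_lt_pow_iff_right one_lt_two).1 this

theorem memory_lt_word {N H : ℕ} (hN : 0 < N) :
    1000 * N * (Nat.log 2 N + 1) ^ 2 < (N + H + 2) ^ 10 := by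
  have h1 := log_add_one_le hN
  calc 1000 * N * (Nat.log 2 N + 1) ^ 2 ≤ 1000 * N * N ^ 2 := by gcongr
    _ = 1000 * N ^ 3 := by ring
    -- `3 ^ 7 = 2187` absorbs the constant `1000`, and `N + H + 2 ≥ 3`.
    _ < 3 ^ 7 * (N + H + 2) ^ 3 := by
        have : N ^ 3 ≤ (N + H + 2) ^ 3 := by gcongr; omega
        have : 0 < (N + H + 2) ^ 3 := by positivity
        omega
    _ ≤ (N + H + 2) ^ 7 * (N + H + 2) ^ 3 := by gcongr; omega
    _ = (N + H + 2) ^ 10 := by ring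

/-- The first term covers the records after run `j`, with a further `m` so that the sum of `cur` and
the root is a word; `4 * n` covers the tree and the doubled hop limit. -/
theorem space_bound {n m j L : ℕ} (hj : j ≤ L) (hL : 1 ≤ L) (hn : 0 < n) :
    1 + (j + 1) * m + m ≤ 1000 * (n + m) * L ^ 2 ∧ 4 * n ≤ 1000 * (n + m) * L ^ 2 ∧
      m + 1 ≤ 1000 * (n + m) * L ^ 2 := by
  have h1 : L ≤ L ^ 2 := Nat.le_self_pow two_ne_zero L
  have h2 : (n + m) * L ≤ (n + m) * L ^ 2 := Nat.mul_le_mul_left _ h1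
  have h3 : n + m ≤ (n + m) * L := Nat.le_mul_of_pos_right _ hL
  have h4 : j * m ≤ (n + m) * L := by
    rw [mul_comm]
    exact Nat.mul_le_mul (Nat.le_add_left _ _) hj
  rw [mul_assoc, add_mul]
  omega

theorem time_bound {n m l L : ℕ} (hl : l + 1 ≤ L) (hn : 0 < n) :
    6 * m + 10 + ((l + 2) * ((m + n) * (13 * (l + 1) + 37) + 9) + 1) ≤
      1000 * (n + m) * L ^ 2 := by
  have hL : 1 ≤ L := by omega
  have hN : 1 ≤ n + m := by omega
  calc 6 * m + 10 + ((l + 2) * ((m + n) * (13 * (l + 1) + 37) + 9) + 1)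
      ≤ 6 * (n + m) + 10 * (n + m) +
          ((2 * L) * ((n + m) * (13 * L + 37 * L) + 9 * ((n + m) * L)) + (n + m)) := by
        have h9 : 9 ≤ 9 * ((n + m) * L) := by nlinarith
        have h37 : 37 ≤ 37 * L := by omega
        have h2 : l + 2 ≤ 2 * L := by omega
        have hlL : 13 * (l + 1) ≤ 13 * L := by omega
        have : (l + 2) * ((m + n) * (13 * (l + 1) + 37) + 9) ≤
            (2 * L) * ((n + m) * (13 * L + 37 * L) + 9 * ((n + m) * L)) := by
          rw [add_comm m n]
          gcongr
        omega
    _ = 17 * (n + m) + 118 * ((n + m) * L ^ 2) := by ring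
    _ ≤ 1000 * (n + m) * L ^ 2 := by
        have : n + m ≤ (n + m) * L ^ 2 := Nat.le_mul_of_pos_right _ (by positivity)
        rw [mul_assoc]
        omega

end Bounds

/-! ### Assembly of the runs -/

section Main

variable {n m M W : ℕ} {G : Digraph (Fin n)} {w : Fin n → Fin n → ℝ} {src dst : Fin m → Fin n}
  {s : Fin n} {σ : State} {P : ℕ → List (Fin n)} {j : ℕ}

theorem Outer.isPathOutput (hO : Outer G w src dst s j σ P) (hM : σ.nreg 7 ≤ M) :
    IsPathOutput G w s M (σ.putN 0 (σ.nreg 7)) := by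
  refine ⟨by simpa using hM, ?_, ?_⟩
  · intro i hi h0
    simp only [putN_nreg, putN_nmem, reduceIte] at hi h0 ⊢
    have hi0 : 0 < i := by
      by_contra hc
      obtain rfl : i = 0 := by omega
      rw [hO.records.hp_zero] at h0
      omega
    obtain ⟨h1, h2, -⟩ := hO.records.step i hi0 hi
    exact ⟨h1.trans hi, h2.symm⟩
  · intro i hi
    simp only [putN_nreg, reduceIte] at hi
    obtain ⟨v, -, h1, h2, h3, h4⟩ := hO.records.spec i hi
    exact ⟨v, P i, h1, h4, h2, h3⟩

/-- A path without edges is record `0`. Otherwise the run with the least power of two above `hop p`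
finds `p`; simplicity gives `hop p < n`, so this run took place. -/
theorem Outer.mem_outputPaths (hw : ∀ x y, G.Adj x y → 0 ≤ w x y) (hu : UniqueHopShortest G w)
    (hO : Outer G w src dst s j σ P) (hj : 2 * n ≤ 2 ^ j) {v : Fin n} {p : List (Fin n)}
    (hp : IsStronglyHopDominant G w s v p) : p ∈ outputPaths (σ.putN 0 (σ.nreg 7)) := by
  suffices h : ∃ i < σ.nreg 7, P i = p by
    obtain ⟨i, hi, rfl⟩ := h
    obtain ⟨v, -, -, -, -, h4⟩ := hO.records.spec i hi
    exact ⟨i, by simpa using hi, h4⟩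
  rcases Nat.eq_zero_or_pos (hop p) with h0 | h0
  · refine ⟨0, hO.records.pos, ?_⟩
    rw [hO.records.path_zero]
    obtain ⟨-, h1, -⟩ := hp.1
    cases p with
    | nil => simp at h1
    | cons a t =>
      have ht : t = [] := by simpa [hop] using h0
      simp at h1
      rw [h1, ht]
  · have hnd := hp.nodup hw hu
    have hlen : p.length ≤ n := by simpa using hnd.length_le_card
    have hhop : hop p + 1 = p.length := by unfold hop at h0 ⊢; omega
    have h1 : 2 ^ Nat.log 2 (hop p) ≤ hop p := Nat.pow_log_le_self 2 h0.ne'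
    have h2 : hop p < 2 ^ (Nat.log 2 (hop p) + 1) := Nat.lt_pow_succ_log_self one_lt_two _
    have h3 : 2 ^ (Nat.log 2 (hop p) + 1) = 2 * 2 ^ Nat.log 2 (hop p) := pow_succ' _ _
    -- With `h = 2 ^ (Nat.log 2 (hop p) + 1) ≤ 2 * hop p`, the required budget `h + hop p` is at
    -- most `3 * hop p`, within the given `4 * hop p`.
    refine hO.old p ⟨Nat.log 2 (hop p) + 1, ?_, v, IsHopShortest.mono hp ?_ ?_, h2.le⟩
    · exact (Nat.pow_lt_pow_iff_right one_lt_two).1 (show 2 ^ _ < 2 ^ j by omega)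
    · omega
    · omega

theorem wp_outer_loop (hw : ∀ x y, G.Adj x y → 0 ≤ w x y) (hu : UniqueHopShortest G w)
    (hE : ∀ i, G.Adj (src i) (dst i)) (hE' : ∀ x y, G.Adj x y → ∃ i, src i = x ∧ dst i = y)
    (hnM : 4 * n ≤ M) (hKM : ∀ j, j ≤ Nat.log 2 n + 1 → 1 + (j + 1) * m + m ≤ M) (hMW : M < W)
    (hO : Outer G w src dst s 0 σ P) :
    Wp M W (.loop (.lt 6 13) scaleProg) σ fun σ' t =>
      t ≤ (Nat.log 2 n + 2) * ((m + n) * (13 * Nat.log 2 (2 * n) + 37) + 9) + 1 ∧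
      ∃ j P', 2 * n ≤ 2 ^ j ∧ σ'.nreg 7 ≤ M ∧ Outer G w src dst s j σ' P' := by
  refine (wp_loop (fun B σ' => ∃ j P', j ≤ Nat.log 2 n + 2 ∧ B = (Nat.log 2 n + 2 - j) *
    ((m + n) * (13 * Nat.log 2 (2 * n) + 37) + 9) + 1 ∧ Outer G w src dst s j σ' P') ?_ ?_ _ _
    ⟨0, P, Nat.zero_le _, rfl, hO⟩).mono ?_
  · rintro B σ₁ ⟨j, P', hj, rfl, hO'⟩ hb
    have hb' : 2 ^ j < 2 * n := by
      have : σ₁.nreg 6 < σ₁.nreg 13 := hb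
      rw [hO'.reg6, hO'.static.reg13] at this
      omega
    have hjl := lt_log_add_two hb'
    refine (wp_scale hw hu hE hE' hnM (hKM j (by omega)) hMW hO' hb').mono ?_
    rintro σ₂ t ⟨ht, P₂, hO₂⟩
    refine ⟨_, ?_, j + 1, P₂, by omega, rfl, hO₂⟩
    obtain ⟨d, hd⟩ : ∃ d, Nat.log 2 n + 2 = j + 1 + d := ⟨_, (Nat.add_sub_of_le hjl).symm⟩
    rw [hd, Nat.add_sub_cancel_left, show j + 1 + d - j = d + 1 by omega, add_one_mul d]
    omega
  · rintro B σ₁ ⟨j, P', -, rfl, -⟩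
    omega
  · rintro σ₁ t ⟨ht, hb, B, j, P', hj, -, hO'⟩
    have hb' : ¬ σ₁.nreg 6 < σ₁.nreg 13 := hb
    rw [hO'.reg6, hO'.static.reg13] at hb'
    refine ⟨by simpa using ht, j, P', by omega, hO'.bound.trans ?_, hO'⟩
    have h1 := hKM (Nat.log 2 n + 1) le_rfl
    have h2 : j * m ≤ (Nat.log 2 n + 1 + 1) * m := Nat.mul_le_mul_right _ hj
    omega

theorem wp_main {e : Fin m ≃ {a : Fin n × Fin n // G.Adj a.1 a.2}} {H : ℕ}
    (hw : ∀ x y, G.Adj x y → 0 ≤ w x y) (hu : UniqueHopShortest G w)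
    (hnM : 4 * n ≤ M) (hmM : m + 1 ≤ M)
    (hKM : ∀ j, j ≤ Nat.log 2 n + 1 → 1 + (j + 1) * m + m ≤ M) (hMW : M < W) :
    Wp M W mainProg (inputState (fun i => (e i).1) w s H) fun σ t =>
      t ≤ 6 * m + 10 +
        ((Nat.log 2 n + 2) * ((m + n) * (13 * Nat.log 2 (2 * n) + 37) + 9) + 1) ∧
      IsPathOutput G w s M σ ∧
      ∀ (v : Fin n) (p : List (Fin n)), IsStronglyHopDominant G w s v p → p ∈ outputPaths σ := by
  have hn := s.2
  rw [mainProg, seqs, wp_seq, wp_const]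
  refine ⟨by omega, ?_⟩
  rw [seqs, wp_seq]
  refine (wp_build (src := fun i => (e i).1.1) (by omega) hmM hMW (by simp [inputState])
    (by simp) (by simp [inputState]) (by simp [inputState]) (by simp [inputState])).mono ?_
  rintro σ₁ t₁ ⟨ht₁, hadj, kn, km, kr⟩
  have h0 : σ₁.nreg 0 = n := by rw [kn 0] <;> simp [inputState]
  have h1 : σ₁.nreg 1 = m := by rw [kn 1] <;> simp [inputState]
  have h2 : σ₁.nreg 2 = s := by rw [kn 2] <;> simp [inputState]
  have h4 : σ₁.nreg 4 = 0 := by rw [kn 4] <;> simp [inputState]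
  have h5 : σ₁.nreg 5 = 1 := by rw [kn 5] <;> simp
  have hmem : ∀ a, 2 ≤ a → a ≠ 5 → a ≠ 6 → ∀ i, σ₁.nmem a i = 0 := by
    intro a ha ha5 ha6 i
    rw [km a ha5 ha6]
    simp [inputState, show a ≠ 0 ∧ a ≠ 1 by omega]
  have hrm : ∀ i, σ₁.rmem 1 i = 0 := by
    intro i
    rw [kr]
    simp [inputState]
  simp only [seqs, wp_seq (p := .instr _), wp_seq (p := .loop _ _), wp_store, wp_copy, wp_add,
    wp_skip, putN_nreg, putN_nmem, putN_rmem, storeN_nreg, storeN_nmem, storeN_rmem, h0, h2, h4, h5,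
    reduceIte, Nat.reduceEqDiff, OfNat.zero_ne_ofNat]
  refine ⟨by omega, by omega, by omega, by omega, ?_⟩
  refine (wp_outer_loop (G := G) (w := w) (s := s) (src := fun i => (e i).1.1)
    (dst := fun i => (e i).1.2) (P := fun _ => [s]) hw hu (fun i => (e i).2) ?_ hnM hKM hMW ?_).mono
    ?_
  · intro x y hxy
    exact ⟨e.symm ⟨(x, y), hxy⟩, by simp, by simp⟩
  · refine ⟨?_, by simp, ?_, by simp, ⟨by simp [hmem], ?_⟩, by simp [hmem], ?_⟩
    · refine ⟨by simp [h0], by simp [h1], by simp [h2], by simp [h4], by simp [h5], by simp, ?_, ?_,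
        ?_, by simpa using hadj⟩
      · simp [km, inputState]
      · simp [km, inputState]
      · simp [kr, inputState]
    · refine ⟨by simp, by simp, by simp [hmem], by simp [hrm], rfl, ?_⟩
      intro r hr hr'
      simp at hr'
      omega
    · intro j hj hj'
      simp [hmem, better]
    · rintro p ⟨i, hi, -⟩
      omega
  · rintro σ₂ t₂ ⟨ht₂, j, P', hj, hM, hO⟩
    exact ⟨by omega, by omega, hO.isPathOutput hM, fun v p hp => hO.mem_outputPaths hw hu hj hp⟩

end Main

end HopPaths

theorem mainTheorem2 :
    ∃ (P : HopPaths.Prog) (C k c : ℕ),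
      ∀ (n m : ℕ) (G : Digraph (Fin n)) (w : Fin n → Fin n → ℝ)
        (e : Fin m ≃ {a : Fin n × Fin n // G.Adj a.1 a.2}) (s : Fin n) (H : ℕ),
        (∀ u v : Fin n, G.Adj u v → 0 ≤ w u v) →
        HopPaths.UniqueHopShortest G w →
        ∃ (t : ℕ) (σ : HopPaths.State),
          HopPaths.Exec (C * (n + m) * (Nat.log 2 (n + m) + 1) ^ k) ((n + m + H + 2) ^ c) P
            (HopPaths.inputState (fun i => (e i).1) w s H) t σ ∧
          t ≤ C * (n + m) * (Nat.log 2 (n + m) + 1) ^ k ∧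
          HopPaths.IsPathOutput G w s (C * (n + m) * (Nat.log 2 (n + m) + 1) ^ k) σ ∧
          ∀ (v : Fin n) (p : List (Fin n)),
            HopPaths.IsStronglyHopDominant G w s v p → HopPaths.hop p ≤ H →
            p ∈ HopPaths.outputPaths σ := by
  -- The exponent `2` counts one logarithm for the number of runs and one for the height of the
  -- tree; with exponent `10`, words exceed the number of cells.
  refine ⟨HopPaths.mainProg, 1000, 2, 10, fun n m G w e s H hw hu => ?_⟩
  have hn : 0 < n := s.pos
  have hlog : Nat.log 2 n ≤ Nat.log 2 (n + m) := Nat.log_mono_right (Nat.le_add_right n m)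
  have hspace : ∀ j, j ≤ Nat.log 2 (n + m) + 1 → _ := fun j hj =>
    HopPaths.space_bound (n := n) (m := m) hj (Nat.le_add_left 1 _) hn
  obtain ⟨t, σ, hexec, ht, hout, hall⟩ := HopPaths.wp_main (e := e) (s := s) (H := H) hw hu
    (hspace 0 (Nat.zero_le _)).2.1 (hspace 0 (Nat.zero_le _)).2.2
    (fun j hj => (hspace j (by omega)).1) (HopPaths.memory_lt_word (by omega))
  rw [HopPaths.log_two_mul hn] at ht
  exact ⟨t, σ, hexec, ht.trans (HopPaths.time_bound (by omega) hn), hout,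
    fun v p hp _ => hall v p hp⟩
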